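/- Notation. Let $A_4$ be the $4\times4$ Cartan matrix of type $A_4$, $M$ its root lattice, $M^*=\mathbb Z^4$ the weight lattice, written in the basis of fundamental weights (so $5M=5A_4\mathbb Z^4$), $q=e^{2\pi i\tau}$ with $\operatorname{Im}\tau>0$, $\zeta_n=e^{2\pi i/n}$, and $\eta$ the Dedekind eta function. For $\beta\in M^*$ let $$\theta^{\beta}(\tau)=\sum_{m\in\mathbb Z^4}q^{\frac52\,{}^t(m+\frac15A_4^{-1}\beta)A_4(m+\frac15A_4^{-1}\beta)}$$ be the level-5 $A_4$ theta function; the series converges absolutely and depends only on the class of $\beta$ in $M^*/5M$. For integers $a,b,d$ with $ad=5$ and $0\le b<d$ put $$\Theta^{d,b}(\tau)=\frac{\eta(\tau)^5}{\eta\left(\frac{a\tau+b}{d}\right)}.$$ Consider the weights $\lambda_0=(0,0,0,0)$; $\lambda_j^k=kv_j$ for $1\le j\le 5$ and $k\in\{1,2,3,4,6,7,8,9,11,12\}$, where $v_1=(1,0,0,0)$, $v_2=(0,1,0,0)$, $v_3=(1,1,0,0)$, $v_4=(1,0,1,0)$, $v_5=(1,1,1,0)$; $\lambda_1^k=k(1,0,0,0)$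 for $k=5,10$; $\lambda_9=(1,1,1,1)$; and, for $k=1,2$, $\lambda_6^k=k(1,0,0,1)$, $\lambda_7^k=k(2,0,1,0)$, $\lambda_8^k=k(0,1,1,0)$, $\lambda_{10}^k=k(3,1,0,0)$, $\lambda_{11}^k=k(1,2,0,0)$, $\lambda_{12}^k=k(1,0,3,0)$. Theorem. (1) These are 66 distinct weights, and they form a complete system of representatives, without repetition, of the orbits of $M^*/5M$ under the Weyl group together with $\beta\mapsto-\beta$. The function $\theta^\beta$ depends only on this orbit of $\beta$. (2) For all $\tau$ with $\operatorname{Im}\tau>0$ one has $\Theta^{1,0}=\tilde\Theta^{1,0}$ and $\Theta^{5,b}=\tilde\Theta^{5,b}$ for $b=0,1,2,3,4$, where $$\tilde\Theta^{1,0}=\theta^{\lambda_0}+2\theta^{\lambda_1^5}+2\theta^{\lambda_1^{10}}-5\theta^{\lambda_9},$$ $$\begin{aligned}\tilde\Theta^{5,b}=\zeta_{24}^{-5b}\Big(5\theta^{\lambda_9}&+\zeta_5^{b}\big(\theta^{\lambda_6^1}+2\theta^{\lambda_{10}^1}+2\theta^{\lambda_{11}^2}\big)+\zeta_5^{2b}\big(\theta^{\lambda_8^1}+2\theta^{\lambda_7^2}+2\theta^{\lambda_{12}^1}\big)\\&+\zeta_5^{3b}\big(\theta^{\lambda_8^2}+2\theta^{\lambda_7^1}+2\theta^{\lambda_{12}^2}\big)+\zeta_5^{4b}\big(\theta^{\lambda_6^2}+2\theta^{\lambda_{10}^2}+2\theta^{\lambda_{11}^1}\big)\Big).\end{aligned}$$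 (3) The functions $\tilde\Theta^{d,b}$, and likewise the functions $\Theta^{d,b}$, satisfy $$\tilde\Theta^{1,0}(-\tfrac1\tau)=(-i\tau)^2\sqrt5\,\tilde\Theta^{5,0}(\tau),\qquad \tilde\Theta^{5,1}(-\tfrac1\tau)=(-i\tau)^2\zeta_8\,\tilde\Theta^{5,4}(\tau),\qquad \tilde\Theta^{5,b}(-\tfrac1\tau)=(-i\tau)^2\,\tilde\Theta^{5,b}(\tau)\quad(b=2,3).$$ (4) For all integers $a,b,d$ with $ad=5$ and $0\le b<d$ there are integers $n_\beta,k_{1,\beta},k_{2,\beta}$, for $\beta\in M^*/5M$, such that for all $\tau$ with $\operatorname{Im}\tau>0$ $$\Theta^{d,b}(\tau)=\sum_{\beta\in M^*/5M}n_\beta\,\zeta_{24}^{k_{1,\beta}}\zeta_{25}^{k_{2,\beta}}\,\theta^\beta(\tau).$$ -/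

import Mathlib

noncomputable section

namespace A4Theta

open Complex

/-- The Cartan matrix of type `A₄`. -/
def cartan : Matrix (Fin 4) (Fin 4) ℤ := CartanMatrix.A 4

/-- Weights are written in the basis of fundamental weights: `β = (b₁, b₂, b₃, b₄)`
stands for `∑ bᵢ ωᵢ`, so the weight lattice `M*` is `ℤ⁴`. -/
abbrev Weight : Type := Fin 4 → ℤ

/-- The sublattice `5M` of the weight lattice, `M` being the root lattice. In the basis of
fundamental weights, the root `∑ vᵢ αᵢ` is the vector `cartan *ᵥ v`. -/
def fiveM : Submodule ℤ Weight := LinearMap.range ((5 : ℤ) • cartan.mulVecLin)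

/-- `M* / 5M`. -/
abbrev WeightClass : Type := Weight ⧸ fiveM

/-- The vector `m + (1/5) A₄⁻¹ β`. -/
def shifted (β : Weight) (m : Fin 4 → ℤ) : Fin 4 → ℝ :=
  (fun i => (m i : ℝ)) +
    (1 / 5 : ℝ) • ((cartan.map (Int.cast : ℤ → ℝ))⁻¹.mulVec (fun i => (β i : ℝ)))

/-- The exponent of `q`: `(5/2) ᵗx A₄ x` with `x = m + (1/5) A₄⁻¹ β`. -/
def thetaExponent (β : Weight) (m : Fin 4 → ℤ) : ℝ :=
  5 / 2 * (shifted β m ⬝ᵥ (cartan.map (Int.cast : ℤ → ℝ)).mulVec (shifted β m))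

/-- The summand `q ^ ((5/2) ᵗx A₄ x)` with `q = exp (2 π i τ)`. -/
def thetaTerm (β : Weight) (τ : ℂ) (m : Fin 4 → ℤ) : ℂ :=
  cexp (2 * Real.pi * I * τ * (thetaExponent β m : ℂ))

/-- The level 5 theta function `θ^β` of type `A₄`. -/
def theta (β : Weight) (τ : ℂ) : ℂ := ∑' m : Fin 4 → ℤ, thetaTerm β τ m

theorem cartan_det_ne : IsUnit (cartan.map (Int.cast : ℤ → ℝ)).det := by
  have h : cartan.det = 5 := by decide +kernel
  have h2 : (cartan.map (Int.cast : ℤ → ℝ)).det = ((cartan.det : ℤ) : ℝ) :=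
    ((Int.castRingHom ℝ).map_det cartan).symm
  rw [h2, h]
  norm_num

theorem shifted_add (β : Weight) (v m : Fin 4 → ℤ) :
    shifted (β + (5 : ℤ) • cartan.mulVec v) m = shifted β (m + v) := by
  have h1 : (fun i => (((β + (5 : ℤ) • cartan.mulVec v) i : ℤ) : ℝ)) =
      (fun i => (β i : ℝ)) +
        (5 : ℝ) • (cartan.map (Int.cast : ℤ → ℝ)).mulVec (fun i => (v i : ℝ)) := by
    funext i
    simp [Matrix.mulVec, dotProduct]
  unfold shifted
  rw [h1, Matrix.mulVec_add, Matrix.mulVec_smul, Matrix.mulVec_mulVec,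
    Matrix.nonsing_inv_mul _ cartan_det_ne, Matrix.one_mulVec]
  funext i
  simp
  ring

theorem theta_add (β : Weight) (v : Fin 4 → ℤ) (τ : ℂ) :
    theta (β + (5 : ℤ) • cartan.mulVec v) τ = theta β τ := by
  have h : ∀ m, thetaTerm (β + (5 : ℤ) • cartan.mulVec v) τ m = thetaTerm β τ (m + v) := by
    intro m
    simp only [thetaTerm, thetaExponent, shifted_add]
  unfold theta
  simp only [h]
  exact (Equiv.addRight v).tsum_eq (thetaTerm β τ)

/-- `θ^β` as a function of the class of `β` in `M* / 5M`. -/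
def thetaClass (c : WeightClass) (τ : ℂ) : ℂ :=
  Quotient.liftOn' c (fun β => theta β τ) (by
    intro β γ h
    obtain ⟨v, hv⟩ := LinearMap.mem_range.mp ((Submodule.quotientRel_def fiveM).mp h)
    have e : β = γ + (5 : ℤ) • cartan.mulVec v := by
      have hv' : (5 : ℤ) • cartan.mulVec v = β - γ := hv
      rw [hv']; abel
    change theta β τ = theta γ τ
    rw [e, theta_add])

theorem cartan_diag (i : Fin 4) : (LinearMap.proj i : Weight →ₗ[ℤ] ℤ) (cartan i) = 2 := by
  revert i; decide

/-- The simple reflection `β ↦ β - bᵢ αᵢ`; the row `cartan i` is the simple root `αᵢ` in the basis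
of fundamental weights. -/
def simpleReflection (i : Fin 4) : Weight ≃ₗ[ℤ] Weight :=
  Module.reflection (cartan_diag i)

/-- The Weyl group, acting on the weight lattice. -/
def weylGroup : Subgroup (Weight ≃ₗ[ℤ] Weight) :=
  Subgroup.closure (Set.range simpleReflection)

/-- `β` and `γ` have the same class in `M* / 5M` up to the Weyl group and `±1`. -/
def SameOrbit (β γ : Weight) : Prop :=
  ∃ w ∈ weylGroup, β - w γ ∈ fiveM ∨ β + w γ ∈ fiveM

end A4Theta

end

namespace A4Theta

/-- The list of weights `λ₀, λ₁ᵏ, …, λ₁₂ᵏ`. -/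
def orbitReps : Finset Weight :=
  {![0, 0, 0, 0], ![1, 1, 1, 1], ![5, 0, 0, 0], ![10, 0, 0, 0]} ∪
  (({1, 2, 3, 4, 6, 7, 8, 9, 11, 12} : Finset ℤ) ×ˢ
    ({![1, 0, 0, 0], ![0, 1, 0, 0], ![1, 1, 0, 0], ![1, 0, 1, 0], ![1, 1, 1, 0]} :
      Finset Weight)).image (fun p => p.1 • p.2) ∪
  (({1, 2} : Finset ℤ) ×ˢ
    ({![1, 0, 0, 1], ![2, 0, 1, 0], ![0, 1, 1, 0], ![3, 1, 0, 0], ![1, 2, 0, 0],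
      ![1, 0, 3, 0]} : Finset Weight)).image (fun p => p.1 • p.2)

end A4Theta

noncomputable section

namespace A4Theta

open Complex

/-- `ζₙ = exp (2 π i / n)`. -/
def zeta (n : ℕ) : ℂ := cexp (2 * Real.pi * I / n)

/-- `η(τ)⁵ / η((aτ + b) / d)`. -/
def etaQuotient (a b d : ℤ) (τ : ℂ) : ℂ :=
  ModularForm.eta τ ^ 5 / ModularForm.eta ((a * τ + b) / d)

/-- The combination for `(a, b, d) = (5, 0, 1)`. -/
def thetaTilde₁ (τ : ℂ) : ℂ :=
  theta ![0, 0, 0, 0] τ + 2 * theta ![5, 0, 0, 0] τ + 2 * theta ![10, 0, 0, 0] τ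
    - 5 * theta ![1, 1, 1, 1] τ

/-- The combination for `(a, b, d) = (1, b, 5)`. -/
def thetaTilde₅ (b : ℤ) (τ : ℂ) : ℂ :=
  zeta 24 ^ (-5 * b) *
    (5 * theta ![1, 1, 1, 1] τ
      + zeta 5 ^ b *
        (theta ![1, 0, 0, 1] τ + 2 * theta ![3, 1, 0, 0] τ + 2 * theta ![2, 4, 0, 0] τ)
      + zeta 5 ^ (2 * b) *
        (theta ![0, 1, 1, 0] τ + 2 * theta ![4, 0, 2, 0] τ + 2 * theta ![1, 0, 3, 0] τ)
      + zeta 5 ^ (3 * b) *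
        (theta ![0, 2, 2, 0] τ + 2 * theta ![2, 0, 1, 0] τ + 2 * theta ![2, 0, 6, 0] τ)
      + zeta 5 ^ (4 * b) *
        (theta ![2, 0, 0, 2] τ + 2 * theta ![6, 2, 0, 0] τ + 2 * theta ![1, 2, 0, 0] τ))

/-- The transformation laws under `τ ↦ -1/τ` of a family `F₁`, `F₅ b` of functions on the upper
half-plane. -/
def STransformationLaws (F₁ : ℂ → ℂ) (F₅ : ℤ → ℂ → ℂ) : Prop :=
  ∀ τ : ℂ, 0 < τ.im →
    F₁ (-1 / τ) = (-I * τ) ^ 2 * (Real.sqrt 5 : ℂ) * F₅ 0 τ ∧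
    F₅ 1 (-1 / τ) = (-I * τ) ^ 2 * zeta 8 * F₅ 4 τ ∧
    F₅ 2 (-1 / τ) = (-I * τ) ^ 2 * F₅ 2 τ ∧
    F₅ 3 (-1 / τ) = (-I * τ) ^ 2 * F₅ 3 τ

end A4Theta

end

noncomputable section

namespace A4Theta

open Complex Filter Topology

/-! The theta identities come from the Jacobi triple product. Multiplying five Jacobi theta
functions, shifted by `j/5` or by `(2 - j)τ`, gives a single theta function times a quotient of
Euler products (`prod_jacobiTheta₂_div`, `prod_jacobiTheta₂_shift`). The constant term in the
elliptic variable is that quotient on one side. On the other it is a sum over integer vectors of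
length five with sum zero, that is, over the lattice `A₄`. The second shift yields η(5τ)⁵/η(τ) = θ^ρ
(`theta_rho`); the first yields η(τ)⁵/η(5τ) as a lattice sum twisted by a character of order 5.

Both are rewritten by a similarity of `A₄` with square 5 (`sqrtFive`). It cuts the twisted sum, and
also θ^ρ(τ/5) = η(τ)⁵/η(τ/5), into 25 classes modulo `5M`. Sorting the classes into orbits gives the
identities for `(a, b, d) = (5, 0, 1)` and `(1, 0, 5)`; translating τ by `b` gives the others.

The orbits are settled by an invariant. Reflection across alcove walls brings every weight into the
closed alcove, where reversal leaves 66 candidates (`exists_alcoveReps`). An integer invariant takes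
66 values on them and the same 66 on the listed weights, which proves completeness and irredundancy
together (`sameOrbit_iff`).

The inversion laws are proved for eta quotients, by writing each modular substitution as a word in
translations and inversions and following the logarithms, and are then carried over to the theta
side. -/

theorem hasSum_of_eq {ι : Type*} {f g : ι → ℂ} {a : ℂ} (hg : HasSum g a) (h : ∀ i, f i = g i) :
    HasSum f a :=
  (funext h : f = g) ▸ hg

/-! ### The Jacobi triple product -/

/-- The finite product `∏_{i < n} (1 - q ^ (i + 1))`. -/
def qPoch (q : ℂ) (n : ℕ) : ℂ := ∏ i ∈ Finset.range n, (1 - q ^ (i + 1))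

/-- The reciprocal of `qPoch`, extended by zero to negative indices. -/
def qPochInv (q : ℂ) (n : ℤ) : ℂ := if n < 0 then 0 else (qPoch q n.toNat)⁻¹

/-- The extension by zero is consistent at `n = 0`, where the factor `1 - q ^ 0` vanishes. The
recursion therefore has no boundary cases. -/
theorem qPochInv_sub_one {q : ℂ} (hq : ∀ n : ℕ, q ^ (n + 1) ≠ 1) (n : ℤ) :
    qPochInv q (n - 1) = (1 - q ^ n) * qPochInv q n := by
  rcases lt_trichotomy n 0 with h | rfl | h
  · simp [qPochInv, h, show n - 1 < 0 by omega]
  · simp [qPochInv]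
  · obtain ⟨m, rfl⟩ : ∃ m : ℕ, n = m + 1 := ⟨(n - 1).toNat, by omega⟩
    have h1 : (1 : ℂ) - q ^ (m + 1) ≠ 0 := sub_ne_zero.mpr (hq m).symm
    have h2 : ((m : ℤ) + 1).toNat = m + 1 := by omega
    rw [qPochInv, qPochInv, if_neg (by omega), if_neg (by omega), h2]
    simp only [add_sub_cancel_right, Int.toNat_natCast, qPoch, Finset.prod_range_succ, mul_inv]
    have h3 : q ^ ((m : ℤ) + 1) = q ^ (m + 1) := by norm_cast
    rw [h3]
    field_simp

/-- The coefficients of the finite form of the Jacobi triple product. -/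
def tripleCoeff (q : ℂ) (N : ℕ) (k : ℤ) : ℂ :=
  qPoch q (2 * N) * qPochInv q (N - k) * qPochInv q (N + k)

/-- The coefficients are Gaussian binomials in `q = x ^ 2`. This is the comparison of coefficients
of `z ^ k` after multiplying by `(1 + z x^(2N+1)) (1 + z⁻¹ x^(2N+1))`. -/
theorem tripleCoeff_succ {x : ℂ} (hx : x ≠ 0) (hq : ∀ n : ℕ, (x ^ 2) ^ (n + 1) ≠ 1)
    (N : ℕ) (k : ℤ) :
    tripleCoeff (x ^ 2) (N + 1) k * x ^ (k ^ 2) =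
      (1 + x ^ (4 * N + 2)) * (tripleCoeff (x ^ 2) N k * x ^ (k ^ 2)) +
      x ^ (2 * N + 1) * (tripleCoeff (x ^ 2) N (k - 1) * x ^ ((k - 1) ^ 2)) +
      x ^ (2 * N + 1) * (tripleCoeff (x ^ 2) N (k + 1) * x ^ ((k + 1) ^ 2)) := by
  have e1 : qPoch (x ^ 2) (2 * (N + 1)) =
      qPoch (x ^ 2) (2 * N) * (1 - x ^ (4 * N + 2)) * (1 - x ^ (4 * N + 4)) := by
    simp only [qPoch, mul_add, mul_one, Finset.prod_range_succ]
    ring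
  have r := qPochInv_sub_one hq
  have u1 : qPochInv (x ^ 2) (N - k) =
      (1 - (x ^ 2) ^ (N - k + 1)) * qPochInv (x ^ 2) (N - k + 1) := by
    rw [← r]; congr 1; ring
  have u2 : qPochInv (x ^ 2) (N - k - 1) =
      (1 - (x ^ 2) ^ (N - k)) * ((1 - (x ^ 2) ^ (N - k + 1)) * qPochInv (x ^ 2) (N - k + 1)) := by
    rw [r, u1]
  have v1 : qPochInv (x ^ 2) (N + k) =
      (1 - (x ^ 2) ^ (N + k + 1)) * qPochInv (x ^ 2) (N + k + 1) := by
    rw [← r]; congr 1; ring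
  have v2 : qPochInv (x ^ 2) (N + k - 1) =
      (1 - (x ^ 2) ^ (N + k)) * ((1 - (x ^ 2) ^ (N + k + 1)) * qPochInv (x ^ 2) (N + k + 1)) := by
    rw [r, v1]
  have c1 : tripleCoeff (x ^ 2) (N + 1) k =
      qPoch (x ^ 2) (2 * N) * (1 - x ^ (4 * N + 2)) * (1 - x ^ (4 * N + 4)) *
        qPochInv (x ^ 2) (N - k + 1) * qPochInv (x ^ 2) (N + k + 1) := by
    rw [tripleCoeff, e1]
    congr 2
    · congr 1; push_cast; ring
    · push_cast; ring
  have c2 : tripleCoeff (x ^ 2) N (k - 1) =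
      qPoch (x ^ 2) (2 * N) * qPochInv (x ^ 2) (N - k + 1) * qPochInv (x ^ 2) (N + k - 1) := by
    rw [tripleCoeff]; congr 2
    · congr 1; ring
    · ring
  have c3 : tripleCoeff (x ^ 2) N (k + 1) =
      qPoch (x ^ 2) (2 * N) * qPochInv (x ^ 2) (N - k - 1) * qPochInv (x ^ 2) (N + k + 1) := by
    rw [tripleCoeff]; congr 2
    · congr 1; ring
    · ring
  rw [c1, c2, c3, tripleCoeff, u1, u2, v1, v2]
  have hx2 : x ^ 2 ≠ 0 := pow_ne_zero _ hx
  have p1 : x ^ ((k - 1) ^ 2) = x ^ (k ^ 2) * (x ^ k)⁻¹ ^ 2 * x := by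
    rw [show (k - 1) ^ 2 = k ^ 2 - k - k + 1 by ring, zpow_add₀ hx, zpow_sub₀ hx, zpow_sub₀ hx, zpow_one]
    field_simp
  have p2 : x ^ ((k + 1) ^ 2) = x ^ (k ^ 2) * (x ^ k) ^ 2 * x := by
    rw [show (k + 1) ^ 2 = k ^ 2 + k + k + 1 by ring, zpow_add₀ hx, zpow_add₀ hx, zpow_add₀ hx, zpow_one]
    ring
  have y : x ^ k ≠ 0 := zpow_ne_zero _ hx
  have q1 : (x ^ 2) ^ (N - k : ℤ) = x ^ (2 * N) * (x ^ k)⁻¹ ^ 2 := by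
    rw [zpow_sub₀ hx2, zpow_natCast, ← pow_mul, ← zpow_natCast x 2, ← zpow_mul, mul_comm _ k,
      zpow_mul, zpow_natCast]
    simp [div_eq_mul_inv]
  have q2 : (x ^ 2) ^ (N + k : ℤ) = x ^ (2 * N) * (x ^ k) ^ 2 := by
    rw [zpow_add₀ hx2, zpow_natCast, ← pow_mul, ← zpow_natCast x 2, ← zpow_mul, mul_comm _ k,
      zpow_mul, zpow_natCast]
  rw [p1, p2, zpow_add_one₀ hx2, zpow_add_one₀ hx2, q1, q2]
  generalize x ^ k = Y at *
  generalize x ^ (k ^ 2) = Z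
  generalize qPochInv (x ^ 2) (N - k + 1) = R
  generalize qPochInv (x ^ 2) (N + k + 1) = S
  generalize qPoch (x ^ 2) (2 * N) = Q
  rw [show x ^ (4 * N + 2) = (x ^ (2 * N)) ^ 2 * x ^ 2 by ring,
    show x ^ (4 * N + 4) = (x ^ (2 * N)) ^ 2 * x ^ 4 by ring,
    show x ^ (2 * N + 1) = (x ^ (2 * N)) * x by ring]
  generalize x ^ (2 * N) = X
  field_simp
  ring

theorem hasSum_tripleCoeff {x z : ℂ} (hx : x ≠ 0) (hz : z ≠ 0)
    (hq : ∀ n : ℕ, (x ^ 2) ^ (n + 1) ≠ 1) (N : ℕ) :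
    HasSum (fun k : ℤ => tripleCoeff (x ^ 2) N k * x ^ (k ^ 2) * z ^ k)
      (∏ n ∈ Finset.range N, ((1 + z * x ^ (2 * n + 1)) * (1 + z⁻¹ * x ^ (2 * n + 1)))) := by
  induction N with
  | zero =>
    rw [Finset.prod_range_zero]
    refine hasSum_of_eq (hasSum_ite_eq (0 : ℤ) (1 : ℂ)) fun k => ?_
    rcases lt_trichotomy k 0 with h | rfl | h
    · simp [tripleCoeff, qPochInv, h, h.ne]
    · simp [tripleCoeff, qPochInv, qPoch]
    · simp [tripleCoeff, qPochInv, h, h.ne']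
  | succ N ih =>
    have h1 := ih.mul_left (1 + x ^ (4 * N + 2))
    have h2 := ((Equiv.subRight (1 : ℤ)).hasSum_iff.mpr ih).mul_left (x ^ (2 * N + 1) * z)
    have h3 := ((Equiv.addRight (1 : ℤ)).hasSum_iff.mpr ih).mul_left (x ^ (2 * N + 1) * z⁻¹)
    have h4 := (h1.add h2).add h3
    rw [← add_mul, ← add_mul, show 1 + x ^ (4 * N + 2) + x ^ (2 * N + 1) * z +
      x ^ (2 * N + 1) * z⁻¹ = (1 + z * x ^ (2 * N + 1)) * (1 + z⁻¹ * x ^ (2 * N + 1)) by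
        field_simp; ring, mul_comm (_ * _) (Finset.prod _ _), ← Finset.prod_range_succ
          (fun n => (1 + z * x ^ (2 * n + 1)) * (1 + z⁻¹ * x ^ (2 * n + 1)))] at h4
    refine hasSum_of_eq h4 fun k => ?_
    rw [tripleCoeff_succ hx hq]
    simp only [Function.comp, Equiv.subRight_apply, Equiv.coe_addRight, zpow_sub_one₀ hz,
      zpow_add_one₀ hz]
    field_simp

/-- The finite Jacobi product in the variables `w`, `τ`. -/
def jacobiProd (N : ℕ) (w τ : ℂ) : ℂ :=
  ∏ n ∈ Finset.range N, ((1 + cexp (2 * Real.pi * I * w) * cexp (Real.pi * I * τ) ^ (2 * n + 1)) *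
    (1 + (cexp (2 * Real.pi * I * w))⁻¹ * cexp (Real.pi * I * τ) ^ (2 * n + 1)))

/-- The Euler product `∏ (1 - q ^ n)`. -/
def euler (τ : ℂ) : ℂ := ∏' n, (1 - ModularForm.eta_q n τ)

theorem eta_eq (τ : ℂ) :
    ModularForm.eta τ = cexp (2 * Real.pi * I * τ / 24) * euler τ := by
  simp [ModularForm.eta, euler, Function.Periodic.qParam]

theorem euler_ne_zero {τ : ℂ} (hτ : 0 < τ.im) : euler τ ≠ 0 :=
  ModularForm.eta_tprod_ne_zero hτ

theorem norm_exp_lt_one {τ : ℂ} (hτ : 0 < τ.im) : ‖cexp (2 * Real.pi * I * τ)‖ < 1 :=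
  UpperHalfPlane.norm_exp_two_pi_I_lt_one ⟨τ, hτ⟩

theorem tendsto_qPoch {τ : ℂ} (hτ : 0 < τ.im) :
    Tendsto (qPoch (cexp (2 * Real.pi * I * τ))) atTop (𝓝 (euler τ)) := by
  have h := (ModularForm.multipliable_one_sub_pow (norm_exp_lt_one hτ)).hasProd.tendsto_prod_nat
  simp only [euler, ModularForm.eta_q_eq_pow]
  exact h

theorem tendsto_jacobiProd (w : ℂ) {τ : ℂ} (hτ : 0 < τ.im) :
    Tendsto (fun N => jacobiProd N w τ) atTop (𝓝 (jacobiTheta₂ w τ / euler τ)) := by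
  set x := cexp (Real.pi * I * τ) with hx
  set z := cexp (2 * Real.pi * I * w) with hz
  have hx2 : x ^ 2 = cexp (2 * Real.pi * I * τ) := by
    rw [hx, ← Complex.exp_nat_mul]; congr 1; push_cast; ring
  have hq : ∀ n : ℕ, (x ^ 2) ^ (n + 1) ≠ 1 := by
    intro n h
    have h1 : ‖x ^ 2‖ ^ (n + 1) < 1 :=
      pow_lt_one₀ (norm_nonneg _) (hx2 ▸ norm_exp_lt_one hτ) (Nat.succ_ne_zero n)
    rw [← norm_pow, h, norm_one] at h1
    exact lt_irrefl _ h1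
  have hP : Tendsto (qPoch (x ^ 2)) atTop (𝓝 (euler τ)) := hx2 ▸ tendsto_qPoch hτ
  have hE := euler_ne_zero hτ
  have hI := hP.inv₀ hE
  obtain ⟨A, hA⟩ := (Metric.isBounded_range_of_tendsto _ hP).exists_norm_le
  obtain ⟨B, hB⟩ := (Metric.isBounded_range_of_tendsto _ hI).exists_norm_le
  have hA' : ∀ n, ‖qPoch (x ^ 2) n‖ ≤ A := fun n => hA _ ⟨n, rfl⟩
  have hB0 : 0 ≤ B := (norm_nonneg _).trans (hB _ ⟨0, rfl⟩)
  have hA0 : 0 ≤ A := (norm_nonneg _).trans (hA' 0)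
  have hB' : ∀ n, ‖qPochInv (x ^ 2) n‖ ≤ B := by
    intro n
    rw [qPochInv]
    split_ifs
    · simpa using hB0
    · exact hB _ ⟨n.toNat, rfl⟩
  have term : ∀ k : ℤ, x ^ (k ^ 2) * z ^ k = jacobiTheta₂_term k w τ := by
    intro k
    rw [hx, hz, jacobiTheta₂_term, ← Complex.exp_int_mul, ← Complex.exp_int_mul, ← Complex.exp_add]
    congr 1; push_cast; ring
  have hInv : ∀ k : ℤ, Tendsto (fun N : ℕ => qPochInv (x ^ 2) (N + k)) atTop
      (𝓝 (euler τ)⁻¹) := by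
    intro k
    have h1 : Tendsto (fun N : ℕ => ((N : ℤ) + k).toNat) atTop atTop := by
      refine tendsto_atTop.mpr fun b => ?_
      filter_upwards [eventually_ge_atTop (b + k.natAbs)] with N hN
      omega
    refine (hI.comp h1).congr' ?_
    filter_upwards [eventually_ge_atTop k.natAbs] with N hN
    rw [qPochInv, if_neg (by omega)]
    rfl
  -- Tannery's theorem: each coefficient tends to `1 / euler τ`. The Pochhammer products and their
  -- inverses converge, hence are bounded, so a multiple of the theta series dominates.
  have main : Tendsto (fun N : ℕ => ∑' k : ℤ, tripleCoeff (x ^ 2) N k * x ^ (k ^ 2) * z ^ k) atTop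
      (𝓝 (∑' k : ℤ, (euler τ)⁻¹ * jacobiTheta₂_term k w τ)) := by
    refine tendsto_tsum_of_dominated_convergence
      (bound := fun k => A * B * B * ‖jacobiTheta₂_term k w τ‖) ?_ ?_ ?_
    · exact (((summable_jacobiTheta₂_term_iff w τ).mpr hτ).norm).mul_left _
    · intro k
      simp only [mul_assoc, term]
      simp only [tripleCoeff, sub_eq_add_neg]
      have h2 : Tendsto (fun N : ℕ => qPoch (x ^ 2) (2 * N)) atTop (𝓝 (euler τ)) :=
        hP.comp (tendsto_id.const_mul_atTop' two_pos)
      have h3 := ((h2.mul (hInv (-k))).mul (hInv k)).mul_const (jacobiTheta₂_term k w τ)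
      rwa [mul_inv_cancel₀ hE, one_mul] at h3
    · refine Eventually.of_forall fun N k => ?_
      rw [mul_assoc, term, norm_mul, tripleCoeff, norm_mul, norm_mul]
      gcongr
      · exact hA' _
      · exact hB' _
      · exact hB' _
  rw [tsum_mul_left, ← jacobiTheta₂, mul_comm, ← div_eq_mul_inv] at main
  refine main.congr fun N => ?_
  exact (hasSum_tripleCoeff (Complex.exp_ne_zero _) (Complex.exp_ne_zero _) hq N).tsum_eq

/-! ### Constant terms and sums over `A₄` -/

theorem integral_exp_int (n : ℤ) :
    ∫ t in (0 : ℝ)..1, cexp (2 * Real.pi * I * n * t) = if n = 0 then 1 else 0 := by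
  split_ifs with h
  · simp [h]
  · have h1 : (2 * Real.pi * I * n : ℂ) ≠ 0 := by
      simp [h, Real.pi_ne_zero]
    rw [integral_exp_mul_complex h1]
    have h2 : cexp (2 * Real.pi * I * n) = 1 :=
      Complex.exp_eq_one_iff.mpr ⟨n, by ring⟩
    simp [h2]

theorem norm_exp_int (n : ℤ) (t : ℝ) : ‖cexp (2 * Real.pi * I * n * t)‖ = 1 := by
  rw [show (2 * Real.pi * I * n * t : ℂ) = ((2 * Real.pi * n * t : ℝ) : ℂ) * I by push_cast; ring]
  exact Complex.norm_exp_ofReal_mul_I _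

/-- The constant term of an absolutely convergent trigonometric series is its mean value. -/
theorem hasSum_constantTerm {ι : Type*} [Countable ι] {F : ι → ℂ} (deg : ι → ℤ) {G : ℝ → ℂ}
    (hF : Summable fun i => ‖F i‖)
    (hG : ∀ t : ℝ, HasSum (fun i => F i * cexp (2 * Real.pi * I * deg i * t)) (G t)) :
    HasSum (fun i => if deg i = 0 then F i else 0) (∫ t in (0 : ℝ)..1, G t) := by
  have h := intervalIntegral.hasSum_integral_of_dominated_convergence (μ := MeasureTheory.volume)
    (a := 0) (b := 1) (F := fun i (t : ℝ) => F i * cexp (2 * Real.pi * I * deg i * t)) (f := G)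
    (fun i _ => ‖F i‖)
    (fun i => (by fun_prop : Continuous fun t : ℝ =>
      F i * cexp (2 * Real.pi * I * deg i * t)).aestronglyMeasurable)
    (fun i => Eventually.of_forall fun t _ => by rw [norm_mul, norm_exp_int, mul_one])
    (Eventually.of_forall fun t _ => hF) (by simp) (Eventually.of_forall fun t _ => hG t)
  refine hasSum_of_eq h fun i => ?_
  rw [intervalIntegral.integral_const_mul, integral_exp_int]
  simp

/-- Differences of consecutive coordinates: coordinates on `ℤ⁴ × ℤ` adapted to `A₄ ⊆ ℤ⁵`. -/
def diffEquiv : (Fin 4 → ℤ) × ℤ ≃ ℤ × ℤ × ℤ × ℤ × ℤ where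
  toFun p := (p.1 0, p.1 1 - p.1 0, p.1 2 - p.1 1, p.1 3 - p.1 2, p.2 - p.1 3)
  invFun x := (![x.1, x.1 + x.2.1, x.1 + x.2.1 + x.2.2.1, x.1 + x.2.1 + x.2.2.1 + x.2.2.2.1],
    x.1 + x.2.1 + x.2.2.1 + x.2.2.2.1 + x.2.2.2.2)
  left_inv p := by
    ext i
    · fin_cases i <;> simp
    · simp
  right_inv x := by ext <;> simp

/-- A product of five sequences evaluated at the consecutive differences. -/
def diffProd (f : Fin 5 → ℤ → ℂ) (v : Fin 4 → ℤ) (s : ℤ) : ℂ :=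
  f 0 (v 0) * (f 1 (v 1 - v 0) * (f 2 (v 2 - v 1) * (f 3 (v 3 - v 2) * f 4 (s - v 3))))

theorem summable_norm_diffProd_prod {f : Fin 5 → ℤ → ℂ} (hf : ∀ j, Summable fun n => ‖f j n‖) :
    Summable fun p : (Fin 4 → ℤ) × ℤ => ‖diffProd f p.1 p.2‖ :=
  diffEquiv.summable_iff.mpr
    ((hf 0).mul_norm ((hf 1).mul_norm ((hf 2).mul_norm ((hf 3).mul_norm (hf 4)))))

theorem summable_norm_diffProd {f : Fin 5 → ℤ → ℂ} (hf : ∀ j, Summable fun n => ‖f j n‖) :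
    Summable fun v : Fin 4 → ℤ => ‖diffProd f v 0‖ :=
  (summable_norm_diffProd_prod hf).comp_injective (i := fun v => (v, 0))
    fun _ _ h => (Prod.ext_iff.mp h).1

theorem hasSum_mul_of_summable_norm {ι κ : Type*} {f : ι → ℂ} {g : κ → ℂ} {a b : ℂ}
    (hf : HasSum f a) (hg : HasSum g b) (hf' : Summable fun i => ‖f i‖)
    (hg' : Summable fun i => ‖g i‖) : HasSum (fun p : ι × κ => f p.1 * g p.2) (a * b) :=
  hf.mul hg (summable_mul_of_summable_norm hf' hg')

theorem hasSum_diffProd {f : Fin 5 → ℤ → ℂ} (hf : ∀ j, Summable fun n => ‖f j n‖) :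
    HasSum (fun p : (Fin 4 → ℤ) × ℤ => diffProd f p.1 p.2) (∏ j, ∑' n, f j n) := by
  have s4 := (hf 3).mul_norm (hf 4)
  have s3 := (hf 2).mul_norm s4
  have s2 := (hf 1).mul_norm s3
  have h4 := hasSum_mul_of_summable_norm (hf 3).of_norm.hasSum (hf 4).of_norm.hasSum (hf 3) (hf 4)
  have h3 := hasSum_mul_of_summable_norm (hf 2).of_norm.hasSum h4 (hf 2) s4
  have h2 := hasSum_mul_of_summable_norm (hf 1).of_norm.hasSum h3 (hf 1) s3
  have h1 := hasSum_mul_of_summable_norm (hf 0).of_norm.hasSum h2 (hf 0) s2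
  have h0 := diffEquiv.hasSum_iff.mpr h1
  rw [Fin.prod_univ_five, mul_assoc, mul_assoc, mul_assoc]
  refine hasSum_of_eq h0 fun p => ?_
  rfl

/-- The five differences telescope to the last coordinate `s`, which is thus the total frequency in
`t`. Taking the mean over `t` selects `s = 0`, the vectors of `ℤ⁵` with sum zero. -/
theorem hasSum_diffProd_zero {f : Fin 5 → ℤ → ℂ} (hf : ∀ j, Summable fun n => ‖f j n‖) :
    HasSum (fun v : Fin 4 → ℤ => diffProd f v 0)
      (∫ t in (0 : ℝ)..1, ∏ j, ∑' n, f j n * cexp (2 * Real.pi * I * n * t)) := by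
  have hf' : ∀ t : ℝ, ∀ j, Summable fun n => ‖f j n * cexp (2 * Real.pi * I * n * t)‖ := by
    intro t j
    simpa only [norm_mul, norm_exp_int, mul_one] using hf j
  have h := hasSum_constantTerm (fun p : (Fin 4 → ℤ) × ℤ => p.2) (summable_norm_diffProd_prod hf)
    (fun t => hasSum_of_eq (hasSum_diffProd (hf' t)) fun p => by
      have e : cexp (2 * Real.pi * I * p.2 * t) =
          cexp (2 * Real.pi * I * (p.1 0) * t) *
          (cexp (2 * Real.pi * I * (p.1 1 - p.1 0 : ℤ) * t) *
          (cexp (2 * Real.pi * I * (p.1 2 - p.1 1 : ℤ) * t) *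
          (cexp (2 * Real.pi * I * (p.1 3 - p.1 2 : ℤ) * t) *
          cexp (2 * Real.pi * I * (p.2 - p.1 3 : ℤ) * t)))) := by
        simp only [← Complex.exp_add]
        congr 1
        push_cast
        ring
      rw [e, diffProd, diffProd]
      ring)
  have hinj : Function.Injective fun v : Fin 4 → ℤ => (v, (0 : ℤ)) :=
    fun _ _ h => (Prod.ext_iff.mp h).1
  refine hasSum_of_eq ((hinj.hasSum_iff ?_).mpr h) fun v => by simp
  rintro ⟨v, s⟩ hs
  refine if_neg fun h0 => hs ⟨v, ?_⟩
  simp only at h0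
  rw [h0]

theorem integral_jacobiTheta₂ {τ : ℂ} (hτ : 0 < τ.im) {N : ℤ} (hN : N ≠ 0) (c : ℂ) :
    ∫ t in (0 : ℝ)..1, c * jacobiTheta₂ (N * t) τ = c := by
  have h := hasSum_constantTerm (G := fun t => jacobiTheta₂ (N * t) τ) (fun n : ℤ => N * n)
    ((summable_jacobiTheta₂_term_iff 0 τ).mpr hτ).norm
    (fun t => hasSum_of_eq (hasSum_jacobiTheta₂_term (N * t) hτ) fun n => by
      rw [jacobiTheta₂_term, jacobiTheta₂_term, ← Complex.exp_add]
      congr 1; push_cast; ring)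
  have h1 : HasSum (fun n : ℤ => if N * n = 0 then jacobiTheta₂_term n 0 τ else 0) 1 := by
    refine hasSum_of_eq (hasSum_ite_eq (0 : ℤ) (1 : ℂ)) fun n => ?_
    by_cases hn : n = 0
    · simp [hn, jacobiTheta₂_term]
    · simp [hn, hN]
  rw [intervalIntegral.integral_const_mul, h.unique h1, mul_one]

theorem im_five_mul {τ : ℂ} (hτ : 0 < τ.im) : 0 < (5 * τ).im := by
  simpa using hτ

theorem summable_norm_jacobiTheta₂_term (w : ℂ) {τ : ℂ} (hτ : 0 < τ.im) :
    Summable fun n => ‖jacobiTheta₂_term n w τ‖ :=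
  ((summable_jacobiTheta₂_term_iff w τ).mpr hτ).norm

theorem jacobiTheta₂_term_add (n : ℤ) (w z τ : ℂ) :
    jacobiTheta₂_term n (z + w) τ = jacobiTheta₂_term n w τ * cexp (2 * Real.pi * I * n * z) := by
  rw [jacobiTheta₂_term, jacobiTheta₂_term, ← Complex.exp_add]
  congr 1; ring

/-- The constant term in `t` of a product of five theta functions is a sum over `A₄`. -/
theorem hasSum_of_prod_jacobiTheta₂ {a : Fin 5 → ℂ} {τ τ' K : ℂ} {N : ℤ} (hτ : 0 < τ.im)
    (hτ' : 0 < τ'.im) (hN : N ≠ 0)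
    (h : ∀ t : ℝ, ∏ j, jacobiTheta₂ (t + a j) τ = K * jacobiTheta₂ (N * t) τ') :
    HasSum (fun v => diffProd (fun j n => jacobiTheta₂_term n (a j) τ) v 0) K := by
  have h1 := hasSum_diffProd_zero (f := fun j n => jacobiTheta₂_term n (a j) τ)
    fun j => summable_norm_jacobiTheta₂_term (a j) hτ
  simp only [← jacobiTheta₂_term_add] at h1
  simp only [jacobiTheta₂] at h
  simp only [h] at h1
  have h2 := integral_jacobiTheta₂ hτ' hN K
  simp only [jacobiTheta₂] at h2
  rwa [h2] at h1

/-! ### Fivefold products of theta functions -/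

theorem prod_one_add_root {ζ : ℂ} (h : 1 + ζ + ζ ^ 2 + ζ ^ 3 + ζ ^ 4 = 0) (w : ℂ) :
    (1 + w) * (1 + ζ * w) * (1 + ζ ^ 2 * w) * (1 + ζ ^ 3 * w) * (1 + ζ ^ 4 * w) = 1 + w ^ 5 := by
  have h5 : ζ ^ 5 = 1 := by linear_combination (ζ - 1) * h
  have e1 : (1 + ζ * w) * (1 + ζ ^ 4 * w) = 1 + (ζ + ζ ^ 4) * w + w ^ 2 := by
    linear_combination w ^ 2 * h5
  have e2 : (1 + ζ ^ 2 * w) * (1 + ζ ^ 3 * w) = 1 + (ζ ^ 2 + ζ ^ 3) * w + w ^ 2 := by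
    linear_combination w ^ 2 * h5
  -- After pairing inverse roots, only the two Gaussian periods matter; their sum and their product
  -- are both `-1`.
  have s : (ζ + ζ ^ 4) + (ζ ^ 2 + ζ ^ 3) = -1 := by linear_combination h
  have p : (ζ + ζ ^ 4) * (ζ ^ 2 + ζ ^ 3) = -1 := by
    linear_combination h + (ζ + ζ ^ 2) * h5
  calc _ = (1 + w) * ((1 + ζ * w) * (1 + ζ ^ 4 * w)) * ((1 + ζ ^ 2 * w) * (1 + ζ ^ 3 * w)) := by
        ring
    _ = 1 + w ^ 5 := by
        rw [e1, e2]
        linear_combination (w + w ^ 3) * (1 + w) * s + w ^ 2 * (1 + w) * p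

theorem zeta_pow (n : ℕ) (k : ℕ) : zeta n ^ k = cexp (2 * Real.pi * I * (k / n)) := by
  rw [zeta, ← Complex.exp_nat_mul]; congr 1; ring

theorem zeta_five_sum : 1 + zeta 5 + zeta 5 ^ 2 + zeta 5 ^ 3 + zeta 5 ^ 4 = 0 := by
  have h := (Complex.isPrimitiveRoot_exp 5 (by norm_num)).geom_sum_eq_zero (by norm_num)
  simpa [Finset.sum_range_succ, zeta] using h

theorem zeta_five_pow_five : zeta 5 ^ 5 = 1 := by
  linear_combination (zeta 5 - 1) * zeta_five_sum

theorem prod_jacobiProd_div (N : ℕ) (w τ : ℂ) :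
    ∏ j : Fin 5, jacobiProd N (w + (j : ℕ) / 5) τ = jacobiProd N (5 * w) (5 * τ) := by
  simp only [jacobiProd]
  rw [Finset.prod_comm]
  refine Finset.prod_congr rfl fun n _ => ?_
  have hz : zeta 5 ≠ 0 := Complex.exp_ne_zero _
  have e : ∀ j : ℕ, cexp (2 * Real.pi * I * (w + j / 5)) =
      cexp (2 * Real.pi * I * w) * zeta 5 ^ j := by
    intro j
    rw [zeta_pow, ← Complex.exp_add]
    congr 1; push_cast; ring
  have e5 : cexp (2 * Real.pi * I * (5 * w)) = cexp (2 * Real.pi * I * w) ^ 5 := by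
    rw [← Complex.exp_nat_mul]; congr 1; push_cast; ring
  have f5 : cexp (Real.pi * I * (5 * τ)) = cexp (Real.pi * I * τ) ^ 5 := by
    rw [← Complex.exp_nat_mul]; congr 1; push_cast; ring
  have hinv : 1 + (zeta 5)⁻¹ + (zeta 5)⁻¹ ^ 2 + (zeta 5)⁻¹ ^ 3 + (zeta 5)⁻¹ ^ 4 = 0 := by
    field_simp
    linear_combination zeta_five_sum
  simp only [e, e5, f5]
  generalize cexp (2 * Real.pi * I * w) = z
  generalize cexp (Real.pi * I * τ) = x
  have p1 := prod_one_add_root zeta_five_sum (z * x ^ (2 * n + 1))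
  have p2 := prod_one_add_root hinv (z⁻¹ * x ^ (2 * n + 1))
  rw [show 1 + z ^ 5 * (x ^ 5) ^ (2 * n + 1) = 1 + (z * x ^ (2 * n + 1)) ^ 5 by ring,
    show 1 + (z ^ 5)⁻¹ * (x ^ 5) ^ (2 * n + 1) = 1 + (z⁻¹ * x ^ (2 * n + 1)) ^ 5 by
      rw [← inv_pow]; ring, ← p1, ← p2]
  simp only [Fin.prod_univ_five, mul_inv, ← inv_pow]
  norm_num
  ring

/-- The shift turns the exponent `5(2n+1)` into `2(5n+4-j)+1` in the factors with `z` and into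
`2(5n+j)+1` in those with `z⁻¹`. As `j` varies, each odd exponent below `10N` occurs once in either
family; centring the shifts at 2 makes both ranges start at 1. -/
theorem prod_jacobiProd_shift (N : ℕ) (w τ : ℂ) :
    ∏ j : Fin 5, jacobiProd N (w + (2 - (j : ℕ)) * τ) (5 * τ) = jacobiProd (5 * N) w τ := by
  have f5 : cexp (Real.pi * I * (5 * τ)) = cexp (Real.pi * I * τ) ^ 5 := by
    rw [← Complex.exp_nat_mul]; congr 1; push_cast; ring
  have e : ∀ j : ℕ, cexp (2 * Real.pi * I * (w + (2 - j) * τ)) =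
      cexp (2 * Real.pi * I * w) * (cexp (Real.pi * I * τ) ^ 4 *
        (cexp (Real.pi * I * τ) ^ (2 * j))⁻¹) := by
    intro j
    rw [← Complex.exp_nat_mul, ← Complex.exp_nat_mul, ← Complex.exp_neg, ← Complex.exp_add,
      ← Complex.exp_add]
    congr 1; push_cast; ring
  simp only [jacobiProd, f5, e]
  have hx : cexp (Real.pi * I * τ) ≠ 0 := Complex.exp_ne_zero _
  have hz : cexp (2 * Real.pi * I * w) ≠ 0 := Complex.exp_ne_zero _
  generalize cexp (2 * Real.pi * I * w) = z at *
  generalize cexp (Real.pi * I * τ) = x at *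
  induction N with
  | zero => simp
  | succ N ih =>
    simp only [Finset.prod_range_succ, Finset.prod_mul_distrib] at ih ⊢
    rw [show 5 * (N + 1) = 5 * N + 1 + 1 + 1 + 1 + 1 by ring]
    simp only [Finset.prod_range_succ]
    rw [mul_mul_mul_comm, ih]
    have s1 : ∀ j i : ℕ, j + i = 4 →
        z * (x ^ 4 * (x ^ (2 * j))⁻¹) * (x ^ 5) ^ (2 * N + 1) = z * x ^ (2 * (5 * N + i) + 1) := by
      intro j i hj
      have : x ^ 4 * (x ^ 5) ^ (2 * N + 1) = x ^ (2 * (5 * N + i) + 1) * x ^ (2 * j) := by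
        rw [← pow_mul, ← pow_add, ← pow_add]; congr 1; omega
      field_simp
      linear_combination this
    have s2 : ∀ j : ℕ, (z * (x ^ 4 * (x ^ (2 * j))⁻¹))⁻¹ * (x ^ 5) ^ (2 * N + 1) =
        z⁻¹ * x ^ (2 * (5 * N + j) + 1) := by
      intro j
      have : x ^ (2 * j) * (x ^ 5) ^ (2 * N + 1) = x ^ (2 * (5 * N + j) + 1) * x ^ 4 := by
        rw [← pow_mul, ← pow_add, ← pow_add]; congr 1; omega
      field_simp
      linear_combination this
    simp only [s2]
    simp only [Fin.prod_univ_five, s1 ((0 : Fin 5) : ℕ) 4 rfl, s1 ((1 : Fin 5) : ℕ) 3 rfl,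
      s1 ((2 : Fin 5) : ℕ) 2 rfl, s1 ((3 : Fin 5) : ℕ) 1 rfl, s1 ((4 : Fin 5) : ℕ) 0 rfl]
    norm_num
    ring

theorem prod_jacobiTheta₂_div (w : ℂ) {τ : ℂ} (hτ : 0 < τ.im) :
    ∏ j : Fin 5, jacobiTheta₂ (w + (j : ℕ) / 5) τ =
      euler τ ^ 5 / euler (5 * τ) * jacobiTheta₂ (5 * w) (5 * τ) := by
  have h1 := tendsto_finsetProd (f := fun (j : Fin 5) N => jacobiProd N (w + (j : ℕ) / 5) τ)
    Finset.univ fun j _ => tendsto_jacobiProd (w + (j : ℕ) / 5) hτ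
  simp only [prod_jacobiProd_div] at h1
  have h2 := tendsto_nhds_unique h1 (tendsto_jacobiProd (5 * w) (im_five_mul hτ))
  have e1 := euler_ne_zero hτ
  have e2 := euler_ne_zero (im_five_mul hτ)
  rw [Finset.prod_div_distrib, Finset.prod_const, Finset.card_univ, Fintype.card_fin] at h2
  rw [div_eq_iff (pow_ne_zero 5 e1)] at h2
  rw [h2]
  field_simp

theorem prod_jacobiTheta₂_shift (w : ℂ) {τ : ℂ} (hτ : 0 < τ.im) :
    ∏ j : Fin 5, jacobiTheta₂ (w + (2 - (j : ℕ)) * τ) (5 * τ) =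
      euler (5 * τ) ^ 5 / euler τ * jacobiTheta₂ w τ := by
  have h1 := tendsto_finsetProd
    (f := fun (j : Fin 5) N => jacobiProd N (w + (2 - (j : ℕ)) * τ) (5 * τ))
    Finset.univ fun j _ => tendsto_jacobiProd (w + (2 - (j : ℕ)) * τ) (im_five_mul hτ)
  simp only [prod_jacobiProd_shift] at h1
  have h2 := tendsto_nhds_unique h1 ((tendsto_jacobiProd w hτ).comp
    (tendsto_id.const_mul_atTop' (by norm_num : 0 < 5)))
  have e1 := euler_ne_zero hτ
  have e2 := euler_ne_zero (im_five_mul hτ)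
  rw [Finset.prod_div_distrib, Finset.prod_const, Finset.card_univ, Fintype.card_fin] at h2
  rw [div_eq_iff (pow_ne_zero 5 e2)] at h2
  rw [h2]
  field_simp

/-! ### Eta quotients as lattice sums; convergence of the theta series -/

/-- The quadratic form `ᵗx A₄ x` as a sum of five squares. -/
def cartanForm {R : Type*} [CommRing R] (x : Fin 4 → R) : R :=
  x 0 ^ 2 + (x 1 - x 0) ^ 2 + (x 2 - x 1) ^ 2 + (x 3 - x 2) ^ 2 + x 3 ^ 2

theorem hasSum_euler_div {τ : ℂ} (hτ : 0 < τ.im) :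
    HasSum (fun v : Fin 4 → ℤ => zeta 5 ^ (-(v 0 + v 1 + v 2 + v 3)) *
      cexp (Real.pi * I * τ * (cartanForm v : ℤ))) (euler τ ^ 5 / euler (5 * τ)) := by
  have h := hasSum_of_prod_jacobiTheta₂ (N := 5) hτ (im_five_mul hτ) (by norm_num)
    (a := fun j => (j : ℕ) / 5) (K := euler τ ^ 5 / euler (5 * τ))
    fun t => by simpa using prod_jacobiTheta₂_div t hτ
  refine hasSum_of_eq h fun v => ?_
  simp only [diffProd, jacobiTheta₂_term, ← Complex.exp_add, zeta, ← Complex.exp_int_mul]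
  congr 1
  simp only [cartanForm, Fin.val_zero, Fin.val_one, Fin.val_two,
    show ((3 : Fin 5) : ℕ) = 3 from rfl, show ((4 : Fin 5) : ℕ) = 4 from rfl]
  push_cast
  ring

theorem hasSum_euler_five_div {τ : ℂ} (hτ : 0 < τ.im) :
    HasSum (fun v : Fin 4 → ℤ =>
      cexp (Real.pi * I * τ * (5 * (cartanForm v : ℤ) + 2 * (v 0 + v 1 + v 2 + v 3))))
      (euler (5 * τ) ^ 5 / euler τ) := by
  have h := hasSum_of_prod_jacobiTheta₂ (N := 1) (im_five_mul hτ) hτ (by norm_num)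
    (a := fun j => (2 - (j : ℕ)) * τ) (K := euler (5 * τ) ^ 5 / euler τ)
    fun t => by simpa using prod_jacobiTheta₂_shift t hτ
  refine hasSum_of_eq h fun v => ?_
  simp only [diffProd, jacobiTheta₂_term, ← Complex.exp_add]
  congr 1
  simp only [cartanForm, Fin.val_zero, Fin.val_one, Fin.val_two,
    show ((3 : Fin 5) : ℕ) = 3 from rfl, show ((4 : Fin 5) : ℕ) = 4 from rfl]
  push_cast
  ring

theorem cartan_eq : cartan = !![2, -1, 0, 0; -1, 2, -1, 0; 0, -1, 2, -1; 0, 0, -1, 2] := by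
  decide

/-- The real Cartan matrix. -/
def realCartan : Matrix (Fin 4) (Fin 4) ℝ := cartan.map (Int.cast : ℤ → ℝ)

theorem realCartan_eq :
    realCartan = !![2, -1, 0, 0; -1, 2, -1, 0; 0, -1, 2, -1; 0, 0, -1, 2] := by
  rw [realCartan, cartan_eq]
  ext i j
  fin_cases i <;> fin_cases j <;> simp

theorem dotProduct_realCartan (x : Fin 4 → ℝ) : x ⬝ᵥ realCartan.mulVec x = cartanForm x := by
  rw [realCartan_eq]
  simp [Matrix.mulVec, dotProduct, Fin.sum_univ_four, cartanForm]
  ring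

theorem thetaExponent_eq (β : Weight) (m : Fin 4 → ℤ) :
    thetaExponent β m = 5 / 2 * cartanForm (shifted β m) := by
  rw [← dotProduct_realCartan]; rfl

theorem realCartan_mulVec_shifted (β : Weight) (m : Fin 4 → ℤ) :
    realCartan.mulVec (shifted β m) =
      realCartan.mulVec (fun i => (m i : ℝ)) + (1 / 5 : ℝ) • fun i => (β i : ℝ) := by
  rw [shifted, Matrix.mulVec_add, Matrix.mulVec_smul, Matrix.mulVec_mulVec, realCartan,
    Matrix.mul_nonsing_inv _ cartan_det_ne, Matrix.one_mulVec]

/-- The Cartan matrix is invertible, so `shifted β m` can be identified after multiplying by it.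
Later arguments need no explicit inverse. -/
theorem shifted_eq_of_mulVec {β : Weight} {m : Fin 4 → ℤ} {x : Fin 4 → ℝ}
    (h : realCartan.mulVec x =
      realCartan.mulVec (fun i => (m i : ℝ)) + (1 / 5 : ℝ) • fun i => (β i : ℝ)) :
    shifted β m = x :=
  Matrix.mulVec_injective_iff_isUnit.mpr ((Matrix.isUnit_iff_isUnit_det _).mpr cartan_det_ne)
    ((realCartan_mulVec_shifted β m).trans h.symm)

/-- Expanding the square gives a constant times a Jacobi theta term with elliptic variable `5aτ`. -/
theorem summable_norm_shifted_gaussian (a : ℝ) {τ : ℂ} (hτ : 0 < τ.im) :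
    Summable fun n : ℤ => ‖cexp (5 * Real.pi * I * τ * (n + a) ^ 2)‖ := by
  have h := (summable_norm_jacobiTheta₂_term (5 * a * τ) (im_five_mul hτ)).mul_left
    ‖cexp (5 * Real.pi * I * τ * a ^ 2)‖
  refine h.congr fun n => ?_
  rw [← norm_mul, jacobiTheta₂_term, ← Complex.exp_add]
  congr 2; ring

theorem thetaTerm_eq_diffProd (β : Weight) (τ : ℂ) (m : Fin 4 → ℤ) :
    thetaTerm β τ m = diffProd (fun j n => cexp (5 * Real.pi * I * τ * (n +
      ((![shifted β 0 0, shifted β 0 1 - shifted β 0 0, shifted β 0 2 - shifted β 0 1,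
        shifted β 0 3 - shifted β 0 2, - shifted β 0 3] : Fin 5 → ℝ) j : ℝ)) ^ 2)) m 0 := by
  have h : ∀ i, shifted β m i = m i + shifted β 0 i := fun i => by simp [shifted]
  rw [thetaTerm, thetaExponent_eq]
  simp only [diffProd, ← Complex.exp_add, cartanForm, h]
  congr 1
  simp
  ring

theorem summable_thetaTerm (β : Weight) {τ : ℂ} (hτ : 0 < τ.im) : Summable (thetaTerm β τ) := by
  have h := (summable_norm_diffProd (f := fun j n => cexp (5 * Real.pi * I * τ * (n +
      ((![shifted β 0 0, shifted β 0 1 - shifted β 0 0, shifted β 0 2 - shifted β 0 1,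
        shifted β 0 3 - shifted β 0 2, - shifted β 0 3] : Fin 5 → ℝ) j : ℝ)) ^ 2))
    fun j => summable_norm_shifted_gaussian _ hτ).of_norm
  exact h.congr fun m => (thetaTerm_eq_diffProd β τ m).symm

/-! ### Invariance of theta under the Weyl group and negation -/

theorem simpleReflection_apply (i : Fin 4) (β : Weight) :
    simpleReflection i β = β - β i • cartan i := rfl

theorem simpleReflection_involutive (i : Fin 4) (β : Weight) :
    simpleReflection i (simpleReflection i β) = β :=
  Module.involutive_reflection (cartan_diag i) β

theorem cartan_isSymm (i j : Fin 4) : cartan i j = cartan j i := by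
  rw [cartan_eq]
  fin_cases i <;> fin_cases j <;> rfl

/-- A simple reflection in the coordinates given by the simple roots. -/
def rootReflection (i : Fin 4) (m : Fin 4 → ℤ) : Fin 4 → ℤ :=
  m - Pi.single i (cartan.mulVec m i)

theorem cartan_mulVec_rootReflection (i : Fin 4) (m : Fin 4 → ℤ) :
    cartan.mulVec (rootReflection i m) = simpleReflection i (cartan.mulVec m) := by
  rw [rootReflection, Matrix.mulVec_sub, simpleReflection_apply, Matrix.mulVec_single]
  congr 1
  ext j
  simp [cartan_isSymm i j, mul_comm]

theorem rootReflection_involutive (i : Fin 4) : Function.Involutive (rootReflection i) := by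
  intro m
  have h : cartan.mulVec (rootReflection i m) i = - cartan.mulVec m i := by
    have := cartan_diag i
    rw [cartan_mulVec_rootReflection, simpleReflection_apply]
    simp only [LinearMap.proj_apply] at this
    simp [this]
    ring
  rw [rootReflection, h, rootReflection, Pi.single_neg]
  abel

theorem shifted_simpleReflection (i : Fin 4) (β : Weight) (m : Fin 4 → ℤ) :
    shifted (simpleReflection i β) (rootReflection i m) =
      shifted β m - Pi.single i (realCartan.mulVec (shifted β m) i) := by
  apply shifted_eq_of_mulVec
  rw [Matrix.mulVec_sub, realCartan_mulVec_shifted, Matrix.mulVec_single]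
  have h1 : (fun j => ((rootReflection i m j : ℤ) : ℝ)) =
      (fun j => (m j : ℝ)) - Pi.single i (realCartan.mulVec (fun j => (m j : ℝ)) i) := by
    ext j
    rw [rootReflection, Pi.sub_apply, Pi.sub_apply, Int.cast_sub]
    congr 1
    by_cases hj : j = i
    · subst hj
      simp [realCartan, Matrix.mulVec, dotProduct]
    · simp [hj]
  rw [h1, Matrix.mulVec_sub, Matrix.mulVec_single]
  ext j
  have hs : realCartan j i = cartan i j := by
    rw [realCartan, Matrix.map_apply, cartan_isSymm]
  simp only [Pi.add_apply, Pi.sub_apply, Pi.smul_apply, simpleReflection_apply, smul_eq_mul,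
    Matrix.col_apply, hs, Int.cast_sub, Int.cast_mul, MulOpposite.smul_eq_mul_unop,
    MulOpposite.unop_op]
  ring

theorem cartanForm_reflection (i : Fin 4) (x : Fin 4 → ℝ) :
    cartanForm (x - Pi.single i (realCartan.mulVec x i)) = cartanForm x := by
  rw [realCartan_eq]
  fin_cases i <;>
    simp [cartanForm, Matrix.mulVec, dotProduct, Fin.sum_univ_four] <;> ring

/-- Reflecting the summation index along with the weight reflects the vector `shifted β m`, and
reflections preserve the form. -/
theorem theta_simpleReflection (i : Fin 4) (β : Weight) (τ : ℂ) :
    theta (simpleReflection i β) τ = theta β τ := by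
  rw [theta, ← (rootReflection_involutive i).toPerm.tsum_eq]
  refine tsum_congr fun m => ?_
  rw [Function.Involutive.coe_toPerm, thetaTerm, thetaTerm, thetaExponent_eq, thetaExponent_eq,
    shifted_simpleReflection, cartanForm_reflection]

theorem theta_neg (β : Weight) (τ : ℂ) : theta (-β) τ = theta β τ := by
  rw [theta, ← (Equiv.neg (Fin 4 → ℤ)).tsum_eq]
  refine tsum_congr fun m => ?_
  have h : shifted (-β) (-m) = - shifted β m := by
    apply shifted_eq_of_mulVec
    rw [Matrix.mulVec_neg, realCartan_mulVec_shifted]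
    have e : (fun i => (((-m) i : ℤ) : ℝ)) = - fun i => (m i : ℝ) := by ext; simp
    rw [e, Matrix.mulVec_neg]
    ext j
    simp
    ring
  rw [Equiv.neg_apply, thetaTerm, thetaTerm, thetaExponent_eq, thetaExponent_eq, h]
  congr 4
  simp only [cartanForm, Pi.neg_apply]
  ring

theorem theta_weyl {w : Weight ≃ₗ[ℤ] Weight} (hw : w ∈ weylGroup) (β : Weight) (τ : ℂ) :
    theta (w β) τ = theta β τ := by
  induction hw using Subgroup.closure_induction generalizing β with
  | mem w h =>
    obtain ⟨i, rfl⟩ := h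
    exact theta_simpleReflection i β τ
  | one => rfl
  | mul x y _ _ hx hy => exact (hx (y β)).trans (hy β)
  | inv x _ hx =>
    rw [← hx]
    exact congrArg (theta · τ) (x.apply_symm_apply β)

theorem mem_fiveM {β : Weight} : β ∈ fiveM ↔ ∃ v, (5 : ℤ) • cartan.mulVec v = β :=
  LinearMap.mem_range

theorem theta_eq_of_sameOrbit {β γ : Weight} (h : SameOrbit β γ) (τ : ℂ) :
    theta β τ = theta γ τ := by
  obtain ⟨w, hw, h | h⟩ := h
  · obtain ⟨v, hv⟩ := mem_fiveM.mp h
    rw [← theta_weyl hw γ, ← theta_add (w γ) v, hv]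
    congr 1; abel
  · obtain ⟨v, hv⟩ := mem_fiveM.mp h
    rw [← theta_weyl hw γ, ← theta_neg (w γ), ← theta_add (-w γ) v, hv]
    congr 1; abel

theorem shifted_cartan_mulVec (u m : Fin 4 → ℤ) :
    shifted (cartan.mulVec u) m = fun i => (m i : ℝ) + u i / 5 := by
  apply shifted_eq_of_mulVec
  have e : (fun i => ((cartan.mulVec u i : ℤ) : ℝ)) = realCartan.mulVec fun i => (u i : ℝ) := by
    ext i
    simp [realCartan, Matrix.mulVec, dotProduct]
  rw [e, ← Matrix.mulVec_smul, ← Matrix.mulVec_add]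
  congr 1
  ext i
  simp
  ring

/-- For weights in the root lattice, the theta series in root coordinates. -/
theorem thetaTerm_cartan_mulVec (u : Fin 4 → ℤ) (τ : ℂ) (m : Fin 4 → ℤ) :
    thetaTerm (cartan.mulVec u) τ m =
      cexp (Real.pi * I * τ / 5 * (cartanForm (u + 5 • m) : ℤ)) := by
  rw [thetaTerm, thetaExponent_eq, shifted_cartan_mulVec]
  congr 1
  simp only [cartanForm, Pi.add_apply, Pi.smul_apply]
  push_cast
  simp
  ring

end A4Theta

end

noncomputable section

namespace A4Theta

/-! ### Orbits on `M* / 5M` -/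

theorem simpleReflection_mem (i : Fin 4) : simpleReflection i ∈ weylGroup :=
  Subgroup.subset_closure ⟨i, rfl⟩

theorem simpleReflection_fiveM (i : Fin 4) {β : Weight} (h : β ∈ fiveM) :
    simpleReflection i β ∈ fiveM := by
  obtain ⟨v, rfl⟩ := mem_fiveM.mp h
  exact mem_fiveM.mpr ⟨rootReflection i v, by rw [cartan_mulVec_rootReflection, map_smul]⟩

/-- Carrying `w⁻¹` along lets the induction over the generated subgroup pass through inverses. -/
theorem weyl_fiveM {w : Weight ≃ₗ[ℤ] Weight} (hw : w ∈ weylGroup) :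
    ∀ β ∈ fiveM, w β ∈ fiveM ∧ w⁻¹ β ∈ fiveM := by
  induction hw using Subgroup.closure_induction with
  | mem w h =>
    obtain ⟨i, rfl⟩ := h
    refine fun β hβ => ⟨simpleReflection_fiveM i hβ, ?_⟩
    have e : (simpleReflection i)⁻¹ β = simpleReflection i β :=
      (LinearEquiv.symm_apply_eq _).mpr (simpleReflection_involutive i β).symm
    rw [e]
    exact simpleReflection_fiveM i hβ
  | one => exact fun β hβ => ⟨hβ, hβ⟩
  | mul x y _ _ hx hy =>
    refine fun β hβ => ⟨(hx _ (hy β hβ).1).1, ?_⟩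
    rw [mul_inv_rev]
    exact (hy _ (hx β hβ).2).2
  | inv x _ hx =>
    refine fun β hβ => ⟨(hx β hβ).2, ?_⟩
    rw [inv_inv]
    exact (hx β hβ).1

namespace SameOrbit

theorem of_weyl {w : Weight ≃ₗ[ℤ] Weight} (hw : w ∈ weylGroup) (β : Weight) :
    SameOrbit (w β) β :=
  ⟨w, hw, Or.inl (by simp)⟩

theorem of_sub_mem {β γ : Weight} (h : β - γ ∈ fiveM) : SameOrbit β γ :=
  ⟨1, one_mem _, Or.inl h⟩

theorem neg (β : Weight) : SameOrbit (-β) β :=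
  ⟨1, one_mem _, Or.inr (by simp)⟩

theorem symm {β γ : Weight} (h : SameOrbit β γ) : SameOrbit γ β := by
  obtain ⟨w, hw, h⟩ := h
  have e : w⁻¹ (w γ) = γ := w.symm_apply_apply γ
  refine ⟨w⁻¹, inv_mem hw, h.imp (fun h => ?_) fun h => ?_⟩
  · have := neg_mem (weyl_fiveM hw _ h).2
    rwa [map_sub, e, neg_sub] at this
  · have := (weyl_fiveM hw _ h).2
    rwa [map_add, e, add_comm] at this

theorem trans {β γ δ : Weight} (h : SameOrbit β γ) (h' : SameOrbit γ δ) : SameOrbit β δ := by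
  obtain ⟨w, hw, h⟩ := h
  obtain ⟨w', hw', h'⟩ := h'
  refine ⟨w * w', mul_mem hw hw', ?_⟩
  rw [LinearEquiv.mul_apply]
  rcases h with h | h <;> rcases h' with h' | h' <;> have k := (weyl_fiveM hw _ h').1
  · left
    have := add_mem h k
    rwa [map_sub, sub_add_sub_cancel] at this
  · right
    have := add_mem h k
    rw [map_add] at this
    convert this using 1; abel
  · right
    have := sub_mem h k
    rw [map_sub] at this
    convert this using 1; abel
  · left
    have := sub_mem h k
    rw [map_add] at this
    convert this using 1; abel

end SameOrbit

/-- Five times the coordinates of a weight in the orthogonal projections of the standard basis. -/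
def fiveCoord (β : Weight) : Fin 5 → ℤ :=
  ![4 * β 0 + 3 * β 1 + 2 * β 2 + β 3, -β 0 + 3 * β 1 + 2 * β 2 + β 3,
    -β 0 - 2 * β 1 + 2 * β 2 + β 3, -β 0 - 2 * β 1 - 3 * β 2 + β 3,
    -β 0 - 2 * β 1 - 3 * β 2 - 4 * β 3]

theorem fiveCoord_sub (β γ : Weight) : fiveCoord (β - γ) = fiveCoord β - fiveCoord γ := by
  ext j; fin_cases j <;> simp [fiveCoord] <;> ring

/-- In these coordinates the Weyl group is `S₅` permuting entries, so symmetric functions of them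
are Weyl invariant. -/
theorem fiveCoord_simpleReflection (i : Fin 4) (β : Weight) (j : Fin 5) :
    fiveCoord (simpleReflection i β) j = fiveCoord β (Equiv.swap i.castSucc i.succ j) := by
  rw [simpleReflection_apply, cartan_eq]
  fin_cases i <;> fin_cases j <;> simp [fiveCoord, Equiv.swap_apply_def] <;> ring

theorem fiveCoord_dvd {β : Weight} (h : β ∈ fiveM) (j : Fin 5) : 25 ∣ fiveCoord β j := by
  obtain ⟨v, rfl⟩ := mem_fiveM.mp h
  rw [cartan_eq]
  have h1 : fiveCoord ((5 : ℤ) • Matrix.mulVec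
      !![2, -1, 0, 0; -1, 2, -1, 0; 0, -1, 2, -1; 0, 0, -1, 2] v) j =
      25 * (![v 0, v 1 - v 0, v 2 - v 1, v 3 - v 2, -v 3] : Fin 5 → ℤ) j := by
    fin_cases j <;>
      simp [fiveCoord, dotProduct, Fin.sum_univ_four] <;> ring
  exact ⟨_, h1⟩

/-- The sum of the cubes of the coordinates modulo `25`. -/
def cubeSum (β : Weight) : ℤ := ∑ j, (fiveCoord β j % 25) ^ 3

/-- A complete invariant of the orbits. -/
def orbitInvariant (β : Weight) : ℤ := cubeSum β * cubeSum (-β)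

theorem cubeSum_weyl {w : Weight ≃ₗ[ℤ] Weight} (hw : w ∈ weylGroup) (β : Weight) :
    cubeSum (w β) = cubeSum β := by
  induction hw using Subgroup.closure_induction generalizing β with
  | mem w h =>
    obtain ⟨i, rfl⟩ := h
    simp only [cubeSum, fiveCoord_simpleReflection]
    exact Equiv.sum_comp (Equiv.swap i.castSucc i.succ) fun j => (fiveCoord β j % 25) ^ 3
  | one => rfl
  | mul x y _ _ hx hy => exact (hx (y β)).trans (hy β)
  | inv x _ hx =>
    rw [← hx]
    exact congrArg cubeSum (x.apply_symm_apply β)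

theorem cubeSum_of_sub_mem {β γ : Weight} (h : β - γ ∈ fiveM) : cubeSum β = cubeSum γ := by
  refine Finset.sum_congr rfl fun j _ => ?_
  have := fiveCoord_dvd h j
  rw [fiveCoord_sub, Pi.sub_apply] at this
  rw [(Int.emod_emod_of_dvd _ (dvd_refl _)).symm, Int.emod_emod_of_dvd _ (dvd_refl _),
    Int.ModEq.eq (Int.modEq_iff_dvd.mpr this).symm]

/-- Each cube sum is invariant under the Weyl group and under `5M`; negation only interchanges the
two factors of the product. -/
theorem orbitInvariant_eq_of_sameOrbit {β γ : Weight} (h : SameOrbit β γ) :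
    orbitInvariant β = orbitInvariant γ := by
  obtain ⟨w, hw, h | h⟩ := h
  · have h' : -β - w (-γ) ∈ fiveM := by
      have := neg_mem h
      rw [map_neg]; convert this using 1; abel
    rw [orbitInvariant, orbitInvariant, cubeSum_of_sub_mem h, cubeSum_of_sub_mem h',
      cubeSum_weyl hw, cubeSum_weyl hw]
  · have h1 : β - w (-γ) ∈ fiveM := by
      rw [map_neg]; convert h using 1; abel
    have h2 : -β - w γ ∈ fiveM := by
      convert neg_mem h using 1; abel
    rw [orbitInvariant, orbitInvariant, cubeSum_of_sub_mem h1, cubeSum_of_sub_mem h2,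
      cubeSum_weyl hw, cubeSum_weyl hw, mul_comm]

theorem sameOrbit_simpleReflection (i : Fin 4) (β : Weight) :
    SameOrbit (simpleReflection i β) β :=
  .of_weyl (simpleReflection_mem i) β

theorem simpleReflection_zero (a b c d : ℤ) :
    simpleReflection 0 ![a, b, c, d] = ![-a, b + a, c, d] := by
  rw [simpleReflection_apply, cartan_eq]
  ext j; fin_cases j <;> simp; ring

theorem simpleReflection_one (a b c d : ℤ) :
    simpleReflection 1 ![a, b, c, d] = ![a + b, -b, c + b, d] := by
  rw [simpleReflection_apply, cartan_eq]
  ext j; fin_cases j <;> simp; ring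

theorem simpleReflection_two (a b c d : ℤ) :
    simpleReflection 2 ![a, b, c, d] = ![a, b + c, -c, d + c] := by
  rw [simpleReflection_apply, cartan_eq]
  ext j; fin_cases j <;> simp; ring

theorem simpleReflection_three (a b c d : ℤ) :
    simpleReflection 3 ![a, b, c, d] = ![a, b, c + d, -d] := by
  rw [simpleReflection_apply, cartan_eq]
  ext j; fin_cases j <;> simp; ring

/-- The palindromic word `s₀s₁s₂s₃s₂s₁s₀` is the reflection in the highest root `(1, 0, 0, 1)`. -/
theorem sameOrbit_highestRoot (a b c d : ℤ) :
    SameOrbit ![a - (a + b + c + d), b, c, d - (a + b + c + d)] ![a, b, c, d] := by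
  have h := (sameOrbit_simpleReflection 0 _).trans <| (sameOrbit_simpleReflection 1 _).trans <|
    (sameOrbit_simpleReflection 2 _).trans <| (sameOrbit_simpleReflection 3 _).trans <|
    (sameOrbit_simpleReflection 2 _).trans <| (sameOrbit_simpleReflection 1 _).trans <|
    sameOrbit_simpleReflection 0 ![a, b, c, d]
  simp only [simpleReflection_zero, simpleReflection_one, simpleReflection_two,
    simpleReflection_three] at h
  convert h using 1
  ext j; fin_cases j <;> simp <;> ring

/-- Adding five times the highest root, an element of `5M`, moves the mirror to the remaining alcove
wall, where the coordinates sum to 5. -/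
theorem sameOrbit_affine (a b c d : ℤ) :
    SameOrbit ![a - (a + b + c + d) + 5, b, c, d - (a + b + c + d) + 5] ![a, b, c, d] := by
  refine (SameOrbit.of_sub_mem ?_).trans (sameOrbit_highestRoot a b c d)
  refine mem_fiveM.mpr ⟨![1, 1, 1, 1], ?_⟩
  rw [cartan_eq]
  ext j; fin_cases j <;> simp

/-- The word of length ten is the longest element `w₀`, and `-w₀` is the diagram automorphism. -/
theorem sameOrbit_reverse (a b c d : ℤ) : SameOrbit ![d, c, b, a] ![a, b, c, d] := by
  have h := (sameOrbit_simpleReflection 0 _).trans <| (sameOrbit_simpleReflection 1 _).trans <|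
    (sameOrbit_simpleReflection 2 _).trans <| (sameOrbit_simpleReflection 3 _).trans <|
    (sameOrbit_simpleReflection 0 _).trans <| (sameOrbit_simpleReflection 1 _).trans <|
    (sameOrbit_simpleReflection 2 _).trans <| (sameOrbit_simpleReflection 0 _).trans <|
    (sameOrbit_simpleReflection 1 _).trans <| sameOrbit_simpleReflection 0 ![a, b, c, d]
  have h' := (SameOrbit.neg _).trans h
  simp only [simpleReflection_zero, simpleReflection_one, simpleReflection_two,
    simpleReflection_three] at h'
  convert h' using 1
  ext j; fin_cases j <;> simp <;> ring

/-- The closed fundamental alcove at level `5`. -/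
def InAlcove (β : Weight) : Prop := (∀ i, 0 ≤ β i) ∧ β 0 + β 1 + β 2 + β 3 ≤ 5

/-- The squared distance to an interior point of the alcove. -/
def alcoveDist (β : Weight) : ℤ := ∑ j, fiveCoord (β - 1) j ^ 2

theorem weight_eta (β : Weight) : β = ![β 0, β 1, β 2, β 3] := by
  ext j; fin_cases j <;> rfl

/-- Descent on the squared distance to `ρ = (1, 1, 1, 1)`, which lies strictly inside the alcove.
Reflecting in a violated wall moves the weight to the side of `ρ`, lowering the distance by 50 times
the amount of the violation. -/
theorem exists_alcove (β : Weight) : ∃ γ, InAlcove γ ∧ SameOrbit β γ := by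
  have hD : ∀ γ, 0 ≤ alcoveDist γ := fun γ => Finset.sum_nonneg fun j _ => sq_nonneg _
  induction h : (alcoveDist β).toNat using Nat.strong_induction_on generalizing β with
  | _ n ih =>
    subst h
    have step : ∀ γ, SameOrbit γ β → alcoveDist γ < alcoveDist β →
        ∃ δ, InAlcove δ ∧ SameOrbit β δ := by
      intro γ h1 h2
      obtain ⟨δ, h3, h4⟩ := ih _ (by have := hD γ; have := hD β; omega) γ rfl
      exact ⟨δ, h3, h1.symm.trans h4⟩
    by_cases hi : ∃ i, β i < 0
    · obtain ⟨i, hi⟩ := hi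
      refine step _ (sameOrbit_simpleReflection i β) ?_
      have e : alcoveDist (simpleReflection i β) = alcoveDist β + 50 * β i := by
        rw [simpleReflection_apply, cartan_eq]
        fin_cases i <;> simp [alcoveDist, fiveCoord, Fin.sum_univ_five] <;> ring
      omega
    by_cases hs : β 0 + β 1 + β 2 + β 3 ≤ 5
    · exact ⟨β, ⟨fun i => not_lt.mp fun h => hi ⟨i, h⟩, hs⟩, .of_sub_mem (by simp)⟩
    · have h1 := sameOrbit_affine (β 0) (β 1) (β 2) (β 3)
      rw [← weight_eta β] at h1
      refine step _ h1 ?_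
      have e : alcoveDist ![β 0 - (β 0 + β 1 + β 2 + β 3) + 5, β 1, β 2,
          β 3 - (β 0 + β 1 + β 2 + β 3) + 5] =
          alcoveDist β - 50 * (β 0 + β 1 + β 2 + β 3 - 5) := by
        simp [alcoveDist, fiveCoord, Fin.sum_univ_five]
        ring
      omega

theorem card_orbitReps : orbitReps.card = 66 := by decide +kernel

theorem card_image_orbitInvariant : (orbitReps.image orbitInvariant).card = 66 := by
  decide +kernel

theorem orbitInvariant_injOn : Set.InjOn orbitInvariant orbitReps :=
  Finset.card_image_iff.mp (card_image_orbitInvariant.trans card_orbitReps.symm)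

/-- The alcove weights, one from each pair exchanged by reversal. -/
def alcoveReps : Finset (Fin 6 × Fin 6 × Fin 6 × Fin 6) :=
  Finset.univ.filter fun p => p.1.val + p.2.1.val + p.2.2.1.val + p.2.2.2.val ≤ 5 ∧
    6 * p.1.val + p.2.1.val ≤ 6 * p.2.2.2.val + p.2.2.1.val

/-- The weight with the given coordinates. -/
def alcoveWeight (p : Fin 6 × Fin 6 × Fin 6 × Fin 6) : Weight :=
  ![(p.1.val : ℤ), (p.2.1.val : ℤ), (p.2.2.1.val : ℤ), (p.2.2.2.val : ℤ)]

theorem image_alcoveReps :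
    alcoveReps.image (fun p => orbitInvariant (alcoveWeight p)) =
      orbitReps.image orbitInvariant := by
  decide +kernel

theorem card_alcoveReps : alcoveReps.card = 66 := by decide +kernel

/-- The 66 chosen alcove weights produce the same 66 values as the listed weights, so equal
cardinalities force injectivity. As they also meet every orbit, the invariant separates orbits. -/
theorem orbitInvariant_alcoveWeight_injOn :
    Set.InjOn (fun p => orbitInvariant (alcoveWeight p)) alcoveReps :=
  Finset.card_image_iff.mp (by
    rw [image_alcoveReps, card_image_orbitInvariant, card_alcoveReps])

theorem exists_alcoveReps (β : Weight) : ∃ p ∈ alcoveReps, SameOrbit β (alcoveWeight p) := by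
  obtain ⟨γ, ⟨h0, h5⟩, h⟩ := exists_alcove β
  have b0 := h0 0
  have b1 := h0 1
  have b2 := h0 2
  have b3 := h0 3
  have e : ∀ i, (((⟨(γ i).toNat, by fin_cases i <;> simp <;> omega⟩ : Fin 6).val : ℕ) : ℤ) = γ i :=
    fun i => Int.toNat_of_nonneg (h0 i)
  -- Entries are at most 5, so base 6 compares `(γ 0, γ 1)` with `(γ 3, γ 2)` lexicographically;
  -- reversal is applied when the order is wrong.
  by_cases hl : 6 * γ 0 + γ 1 ≤ 6 * γ 3 + γ 2
  · refine ⟨(⟨(γ 0).toNat, by omega⟩, ⟨(γ 1).toNat, by omega⟩, ⟨(γ 2).toNat, by omega⟩,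
      ⟨(γ 3).toNat, by omega⟩), ?_, ?_⟩
    · simp only [alcoveReps, Finset.mem_filter, Finset.mem_univ, true_and]
      omega
    · rw [alcoveWeight, e, e, e, e, ← weight_eta]
      exact h
  · refine ⟨(⟨(γ 3).toNat, by omega⟩, ⟨(γ 2).toNat, by omega⟩, ⟨(γ 1).toNat, by omega⟩,
      ⟨(γ 0).toNat, by omega⟩), ?_, ?_⟩
    · simp only [alcoveReps, Finset.mem_filter, Finset.mem_univ, true_and]
      omega
    · rw [alcoveWeight, e, e, e, e]
      have := sameOrbit_reverse (γ 0) (γ 1) (γ 2) (γ 3)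
      rw [← weight_eta] at this
      exact h.trans this.symm

/-- `orbitInvariant` is a complete invariant. -/
theorem sameOrbit_iff {β γ : Weight} : SameOrbit β γ ↔ orbitInvariant β = orbitInvariant γ := by
  refine ⟨orbitInvariant_eq_of_sameOrbit, fun h => ?_⟩
  obtain ⟨p, hp, h1⟩ := exists_alcoveReps β
  obtain ⟨q, hq, h2⟩ := exists_alcoveReps γ
  have e : p = q := orbitInvariant_alcoveWeight_injOn hp hq (by
    simp only
    rw [← orbitInvariant_eq_of_sameOrbit h1, ← orbitInvariant_eq_of_sameOrbit h2, h])
  exact h1.trans (e ▸ h2.symm)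

theorem existsUnique_orbitReps (β : Weight) : ∃! μ, μ ∈ orbitReps ∧ SameOrbit β μ := by
  obtain ⟨p, hp, h⟩ := exists_alcoveReps β
  have hm := image_alcoveReps ▸ Finset.mem_image_of_mem _ hp
  obtain ⟨μ, hμ, e⟩ := Finset.mem_image.mp hm
  refine ⟨μ, ⟨hμ, h.trans (sameOrbit_iff.mpr e.symm)⟩, fun ν ⟨hν, h'⟩ => ?_⟩
  exact orbitInvariant_injOn hν hμ ((sameOrbit_iff.mp (h'.symm.trans h)).trans e.symm)

end A4Theta

end

noncomputable section

namespace A4Theta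

open Complex Filter Topology

/-! ### The similarity `√5` and the two basic theta identities -/

/-- A square root of `5` on the root lattice: a similarity of the form `cartanForm`. -/
def sqrtFive (v : Fin 4 → ℤ) : Fin 4 → ℤ :=
  ![-v 0 + 2 * v 1 - 2 * v 3, v 1 + 2 * v 2 - 2 * v 3, -2 * v 0 + 2 * v 1 + v 2,
    -2 * v 0 + 2 * v 2 - v 3]

/-- In the five coordinates with sum zero, the map is `1 + 2s` with `s = c + c⁻¹` and `c` the cyclic
rotation. There `1 + c + c² + c³ + c⁴ = 0`, hence `s² + s = 1` and `(1 + 2s)² = 5`. Since `s` is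
self-adjoint, the form is multiplied by 5. -/
theorem sqrtFive_sqrtFive (v : Fin 4 → ℤ) : sqrtFive (sqrtFive v) = (5 : ℤ) • v := by
  ext i; fin_cases i <;> simp [sqrtFive] <;> ring

theorem sqrtFive_add (v w : Fin 4 → ℤ) : sqrtFive (v + w) = sqrtFive v + sqrtFive w := by
  ext i; fin_cases i <;> simp [sqrtFive] <;> ring

theorem sqrtFive_smul (c : ℤ) (v : Fin 4 → ℤ) : sqrtFive (c • v) = c • sqrtFive v := by
  ext i; fin_cases i <;> simp [sqrtFive] <;> ring

theorem cartanForm_sqrtFive (v : Fin 4 → ℤ) : cartanForm (sqrtFive v) = 5 * cartanForm v := by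
  simp [cartanForm, sqrtFive]; ring

theorem cartanForm_smul (c : ℤ) (v : Fin 4 → ℤ) : cartanForm (c • v) = c ^ 2 * cartanForm v := by
  simp [cartanForm]; ring

/-- Representatives of the root lattice modulo the image of `sqrtFive`. -/
def residue (p : Fin 5 × Fin 5) : Fin 4 → ℤ := ![(p.1.val : ℤ), (p.2.val : ℤ), 0, 0]

theorem residue_bijective :
    Function.Bijective fun p : (Fin 5 × Fin 5) × (Fin 4 → ℤ) => residue p.1 + sqrtFive p.2 := by
  constructor
  · rintro ⟨⟨a, b⟩, k⟩ ⟨⟨a', b'⟩, k'⟩ h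
    have h0 := congrFun h 0
    have h1 := congrFun h 1
    have h2 := congrFun h 2
    have h3 := congrFun h 3
    simp [residue, sqrtFive] at h0 h1 h2 h3
    have ha : a = a' := by ext; omega
    have hb : b = b' := by ext; omega
    subst ha hb
    have hk : k = k' := by
      ext i; fin_cases i <;> simp <;> omega
    rw [hk]
  · intro m
    -- The preimage of `m - residue (a, b)` must be `sqrtFive` of it divided by 5. Divisibility of
    -- entry 1 determines `b`, then entry 0 determines `a`; the other two entries follow.
    obtain ⟨b, hb⟩ : ∃ b : Fin 5, (b.val : ℤ) = (m 1 + 2 * m 2 - 2 * m 3) % 5 :=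
      ⟨⟨((m 1 + 2 * m 2 - 2 * m 3) % 5).toNat, by omega⟩, by simp; omega⟩
    obtain ⟨a, ha⟩ : ∃ a : Fin 5, (a.val : ℤ) = (2 * b.val + m 0 - 2 * m 1 + 2 * m 3) % 5 :=
      ⟨⟨((2 * b.val + m 0 - 2 * m 1 + 2 * m 3) % 5).toNat, by omega⟩, by simp; omega⟩
    obtain ⟨k0, h0⟩ : (5 : ℤ) ∣ -(m 0 - a.val) + 2 * (m 1 - b.val) - 2 * m 3 := by omega
    obtain ⟨k1, h1⟩ : (5 : ℤ) ∣ (m 1 - b.val) + 2 * m 2 - 2 * m 3 := by omega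
    obtain ⟨k2, h2⟩ : (5 : ℤ) ∣ -2 * (m 0 - a.val) + 2 * (m 1 - b.val) + m 2 := by omega
    obtain ⟨k3, h3⟩ : (5 : ℤ) ∣ -2 * (m 0 - a.val) + 2 * m 2 - m 3 := by omega
    refine ⟨((a, b), ![k0, k1, k2, k3]), ?_⟩
    ext i; fin_cases i <;> simp [residue, sqrtFive] <;> omega

theorem tsum_eq_sum_residue {f : (Fin 4 → ℤ) → ℂ} (hf : Summable f) :
    ∑' m, f m = ∑ a : Fin 5, ∑ b : Fin 5, ∑' k, f (residue (a, b) + sqrtFive k) := by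
  have hf' : Summable fun p : (Fin 5 × Fin 5) × (Fin 4 → ℤ) => f (residue p.1 + sqrtFive p.2) :=
    (Equiv.ofBijective _ residue_bijective).summable_iff.mpr hf
  rw [← (Equiv.ofBijective _ residue_bijective).tsum_eq]
  simp only [Equiv.ofBijective_apply]
  rw [hf'.tsum_prod, tsum_fintype, Fintype.sum_prod_type]

theorem im_div_five {τ : ℂ} (hτ : 0 < τ.im) : 0 < (τ / 5).im := by
  rw [show (τ / 5).im = τ.im / 5 by simp]
  positivity

theorem cartan_rho : cartan.mulVec ![2, 3, 3, 2] = ![1, 1, 1, 1] := by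
  decide +kernel

theorem theta_rho (τ : ℂ) (hτ : 0 < τ.im) :
    theta ![1, 1, 1, 1] τ = ModularForm.eta (5 * τ) ^ 5 / ModularForm.eta τ := by
  have h := (hasSum_euler_five_div hτ).mul_left (cexp (2 * Real.pi * I * τ))
  have e : ModularForm.eta (5 * τ) ^ 5 / ModularForm.eta τ =
      cexp (2 * Real.pi * I * τ) * (euler (5 * τ) ^ 5 / euler τ) := by
    have e1 : cexp (2 * Real.pi * I * (5 * τ) / 24) ^ 5 =
        cexp (2 * Real.pi * I * τ) * cexp (2 * Real.pi * I * τ / 24) := by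
      rw [← Complex.exp_nat_mul, ← Complex.exp_add]
      congr 1; push_cast; ring
    have e2 : cexp (2 * Real.pi * I * τ / 24) ≠ 0 := Complex.exp_ne_zero _
    rw [eta_eq, eta_eq, mul_pow, e1]
    field_simp
  rw [e, ← h.tsum_eq, theta, ← cartan_rho]
  refine tsum_congr fun m => ?_
  rw [thetaTerm_cartan_mulVec, ← Complex.exp_add]
  congr 1
  simp [cartanForm]
  ring

theorem summable_theta_cartan (u : Fin 4 → ℤ) {τ : ℂ} (hτ : 0 < τ.im) :
    Summable fun m : Fin 4 → ℤ => cexp (Real.pi * I * τ / 5 * (cartanForm (u + 5 • m) : ℤ)) :=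
  (summable_thetaTerm (cartan.mulVec u) hτ).congr fun m => thetaTerm_cartan_mulVec u τ m

theorem theta_cartan (u : Fin 4 → ℤ) (τ : ℂ) :
    theta (cartan.mulVec u) τ =
      ∑' m : Fin 4 → ℤ, cexp (Real.pi * I * τ / 5 * (cartanForm (u + 5 • m) : ℤ)) :=
  tsum_congr fun m => thetaTerm_cartan_mulVec u τ m

theorem theta_rho_div_five (τ : ℂ) (hτ : 0 < τ.im) :
    theta ![1, 1, 1, 1] (τ / 5) = ∑ a : Fin 5, ∑ b : Fin 5,
      theta (cartan.mulVec (![0, 1, 1, 0] + sqrtFive (residue (a, b)))) τ := by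
  rw [← cartan_rho, theta_cartan, tsum_eq_sum_residue (summable_theta_cartan _ (im_div_five hτ))]
  refine Finset.sum_congr rfl fun a _ => Finset.sum_congr rfl fun b _ => ?_
  rw [theta_cartan]
  refine tsum_congr fun k => ?_
  -- `√5` carries the root coordinates `(2, 3, 3, 2)` of `ρ` to `5 (0, 1, 1, 0)`. A common factor 5
  -- comes out, and the change of scale absorbs the division of τ by 5.
  have h : sqrtFive (![2, 3, 3, 2] + 5 • (residue (a, b) + sqrtFive k)) =
      (5 : ℤ) • (![0, 1, 1, 0] + sqrtFive (residue (a, b)) + 5 • k) := by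
    rw [← natCast_zsmul, ← natCast_zsmul, sqrtFive_add, sqrtFive_smul, sqrtFive_add,
      sqrtFive_sqrtFive]
    have : sqrtFive ![2, 3, 3, 2] = (5 : ℤ) • ![0, 1, 1, 0] := by decide
    rw [this]
    simp only [smul_add]
    abel
  have h2 := cartanForm_sqrtFive (![2, 3, 3, 2] + 5 • (residue (a, b) + sqrtFive k))
  rw [h, cartanForm_smul] at h2
  have h3 : cartanForm (![2, 3, 3, 2] + 5 • (residue (a, b) + sqrtFive k)) =
      5 * cartanForm (![0, 1, 1, 0] + sqrtFive (residue (a, b)) + 5 • k) := by omega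
  rw [h3]
  congr 1
  push_cast
  ring

theorem theta_eq_of_orbitInvariant {β γ : Weight} (h : orbitInvariant β = orbitInvariant γ)
    (τ : ℂ) : theta β τ = theta γ τ :=
  theta_eq_of_sameOrbit (sameOrbit_iff.mpr h) τ

/-- Orbit representatives of the `25` classes in a coset of `√5 M`. -/
def rhoTable : Matrix (Fin 5) (Fin 5) Weight :=
  !![![1, 0, 0, 1], ![4, 0, 2, 0], ![2, 0, 1, 0], ![6, 2, 0, 0], ![1, 1, 1, 1];
    ![1, 0, 3, 0], ![2, 0, 6, 0], ![2, 0, 0, 2], ![1, 1, 1, 1], ![2, 4, 0, 0];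
    ![2, 0, 6, 0], ![6, 2, 0, 0], ![1, 1, 1, 1], ![3, 1, 0, 0], ![0, 1, 1, 0];
    ![1, 2, 0, 0], ![1, 1, 1, 1], ![3, 1, 0, 0], ![1, 0, 3, 0], ![2, 0, 1, 0];
    ![1, 1, 1, 1], ![2, 4, 0, 0], ![4, 0, 2, 0], ![0, 2, 2, 0], ![1, 2, 0, 0]]

theorem orbitInvariant_rhoTable : ∀ a b : Fin 5,
    orbitInvariant (cartan.mulVec (![0, 1, 1, 0] + sqrtFive (residue (a, b)))) =
      orbitInvariant (rhoTable a b) := by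
  decide +kernel

/-- Orbit representatives of the `25` classes in `√5 M`. -/
def zeroTable : Matrix (Fin 5) (Fin 5) Weight :=
  !![![0, 0, 0, 0], ![1, 1, 1, 1], ![1, 1, 1, 1], ![1, 1, 1, 1], ![1, 1, 1, 1];
    ![1, 1, 1, 1], ![1, 1, 1, 1], ![1, 1, 1, 1], ![1, 1, 1, 1], ![10, 0, 0, 0];
    ![1, 1, 1, 1], ![1, 1, 1, 1], ![1, 1, 1, 1], ![5, 0, 0, 0], ![1, 1, 1, 1];
    ![1, 1, 1, 1], ![1, 1, 1, 1], ![5, 0, 0, 0], ![1, 1, 1, 1], ![1, 1, 1, 1];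
    ![1, 1, 1, 1], ![10, 0, 0, 0], ![1, 1, 1, 1], ![1, 1, 1, 1], ![1, 1, 1, 1]]

theorem orbitInvariant_zeroTable : ∀ a b : Fin 5,
    orbitInvariant (cartan.mulVec (sqrtFive (residue (a, b)))) =
      orbitInvariant (zeroTable a b) := by
  decide +kernel

theorem etaQuotient_zero (τ : ℂ) (hτ : 0 < τ.im) : etaQuotient 1 0 5 τ = thetaTilde₅ 0 τ := by
  have h := theta_rho (τ / 5) (im_div_five hτ)
  rw [theta_rho_div_five τ hτ, mul_div_cancel₀ τ (by norm_num : (5 : ℂ) ≠ 0)] at h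
  have e : etaQuotient 1 0 5 τ = ModularForm.eta τ ^ 5 / ModularForm.eta (τ / 5) := by
    simp [etaQuotient]
  rw [e, ← h]
  simp only [theta_eq_of_orbitInvariant (orbitInvariant_rhoTable _ _)]
  simp [Fin.sum_univ_five, rhoTable, thetaTilde₅]
  ring

theorem zeta_five_zpow_of_dvd {n : ℤ} (h : 5 ∣ n) : zeta 5 ^ n = 1 := by
  obtain ⟨k, rfl⟩ := h
  rw [zpow_mul]
  have : zeta 5 ^ (5 : ℤ) = 1 := by exact_mod_cast zeta_five_pow_five
  rw [this, one_zpow]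

theorem zeta_ne_zero (n : ℕ) : zeta n ≠ 0 := Complex.exp_ne_zero _

theorem euler_div_eq_sum (τ : ℂ) (hτ : 0 < τ.im) :
    euler τ ^ 5 / euler (5 * τ) = ∑ a : Fin 5, ∑ b : Fin 5,
      zeta 5 ^ (4 * (a.val + b.val) % 5) *
        theta (cartan.mulVec (sqrtFive (residue (a, b)))) τ := by
  rw [← (hasSum_euler_div hτ).tsum_eq, tsum_eq_sum_residue (hasSum_euler_div hτ).summable]
  refine Finset.sum_congr rfl fun a _ => Finset.sum_congr rfl fun b _ => ?_
  rw [theta_cartan, ← tsum_mul_left]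
  refine tsum_congr fun k => ?_
  have h : sqrtFive (residue (a, b) + sqrtFive k) = sqrtFive (residue (a, b)) + 5 • k := by
    rw [sqrtFive_add, sqrtFive_sqrtFive, ← natCast_zsmul]; rfl
  rw [← h, cartanForm_sqrtFive]
  congr 1
  -- The character is trivial on the image of `sqrtFive`, whose coordinate sums are multiples of 5;
  -- the factor 4 in the exponent stands for `-1`.
  · rw [← zpow_natCast, ← div_eq_one_iff_eq (zpow_ne_zero _ (zeta_ne_zero 5)),
      ← zpow_sub₀ (zeta_ne_zero 5)]
    apply zeta_five_zpow_of_dvd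
    simp [residue, sqrtFive]
    omega
  · congr 1
    push_cast
    ring

theorem etaQuotient_five (τ : ℂ) (hτ : 0 < τ.im) : etaQuotient 5 0 1 τ = thetaTilde₁ τ := by
  have e : etaQuotient 5 0 1 τ = euler τ ^ 5 / euler (5 * τ) := by
    have e1 : cexp (2 * Real.pi * I * τ / 24) ^ 5 = cexp (2 * Real.pi * I * (5 * τ) / 24) := by
      rw [← Complex.exp_nat_mul]
      congr 1; push_cast; ring
    have e2 : cexp (2 * Real.pi * I * (5 * τ) / 24) ≠ 0 := Complex.exp_ne_zero _
    simp only [etaQuotient, Int.cast_zero, add_zero, Int.cast_one, div_one, Int.cast_ofNat]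
    rw [eta_eq, eta_eq, mul_pow, e1, mul_div_mul_left _ _ e2]
  rw [e, euler_div_eq_sum τ hτ]
  simp only [theta_eq_of_orbitInvariant (orbitInvariant_zeroTable _ _)]
  simp [Fin.sum_univ_five, zeroTable, thetaTilde₁]
  -- The five classes with trivial character give `λ₀` and twice each of `λ₁⁵`, `λ₁¹⁰`. The other
  -- twenty lie in the orbit of `ρ`, five for each nontrivial power of `ζ₅`, so their coefficients
  -- add up to `-5`.
  linear_combination 5 * theta ![1, 1, 1, 1] τ * zeta_five_sum

/-! ### Translations of τ -/

theorem eta_add_one (τ : ℂ) : ModularForm.eta (τ + 1) = zeta 24 * ModularForm.eta τ := by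
  have h : ∀ n, ModularForm.eta_q n (τ + 1) = ModularForm.eta_q n τ := by
    intro n
    rw [ModularForm.eta_q_eq_pow, ModularForm.eta_q_eq_pow, mul_add, Complex.exp_add, mul_one,
      Complex.exp_two_pi_mul_I, mul_one]
  rw [eta_eq, eta_eq, euler, euler, zeta, ← mul_assoc, ← Complex.exp_add]
  simp only [h]
  congr 2
  push_cast
  ring

theorem eta_add_int (τ : ℂ) (b : ℤ) :
    ModularForm.eta (τ + b) = zeta 24 ^ b * ModularForm.eta τ := by
  have hz := zeta_ne_zero 24
  induction b using Int.induction_on with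
  | zero => simp
  | succ n ih =>
    rw [show τ + ((n + 1 : ℤ) : ℂ) = τ + (n : ℤ) + 1 by push_cast; ring, eta_add_one, ih,
      zpow_add_one₀ hz]
    ring
  | pred n ih =>
    have h := eta_add_one (τ + ((-n - 1 : ℤ) : ℂ))
    rw [show τ + ((-n - 1 : ℤ) : ℂ) + 1 = τ + ((-n : ℤ) : ℂ) by push_cast; ring, ih] at h
    rw [zpow_sub_one₀ hz]
    field_simp
    linear_combination -h

/-- The form is even on the root lattice, so `cartanForm` is constant modulo 10 on `u + 5M` in root
coordinates; every term acquires the same power of `ζ₅`. -/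
theorem theta_add_int {β : Weight} (u : Fin 4 → ℤ) (e l : ℤ) (hβ : cartan.mulVec u = β)
    (hu : cartanForm u = 2 * (e + 5 * l)) (b : ℤ) (τ : ℂ) :
    theta β (τ + b) = zeta 5 ^ (e * b) * theta β τ := by
  rw [← hβ, theta_cartan, theta_cartan, ← tsum_mul_left]
  refine tsum_congr fun m => ?_
  obtain ⟨c, hc⟩ : ∃ c, cartanForm (u + 5 • m) = 2 * e + 10 * c := by
    simp only [cartanForm, Pi.add_apply, Pi.smul_apply] at hu ⊢
    refine ⟨l + (u 0 * m 0 + (u 1 - u 0) * (m 1 - m 0) + (u 2 - u 1) * (m 2 - m 1) +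
      (u 3 - u 2) * (m 3 - m 2) + u 3 * m 3) + 5 * (m 0 ^ 2 + m 1 ^ 2 + m 2 ^ 2 + m 3 ^ 2 -
      m 0 * m 1 - m 1 * m 2 - m 2 * m 3), ?_⟩
    simp only [nsmul_eq_mul, Nat.cast_ofNat]
    linear_combination hu
  rw [hc, zeta, ← Complex.exp_int_mul, ← Complex.exp_add, Complex.exp_eq_exp_iff_exists_int]
  refine ⟨c * b, ?_⟩
  push_cast
  ring

theorem etaQuotient_shift (b : ℤ) (τ : ℂ) :
    etaQuotient 1 b 5 τ = zeta 24 ^ (-5 * b) * etaQuotient 1 0 5 (τ + b) := by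
  simp only [etaQuotient, Int.cast_one, one_mul, Int.cast_zero, add_zero]
  rw [eta_add_int, mul_pow, ← zpow_natCast (zeta 24 ^ b) 5, ← zpow_mul, mul_div_assoc, ← mul_assoc,
    ← zpow_add₀ (zeta_ne_zero 24)]
  rw [show -5 * b + b * ((5 : ℕ) : ℤ) = 0 by push_cast; ring, zpow_zero, one_mul]

theorem thetaTilde₅_shift (b : ℤ) (τ : ℂ) :
    thetaTilde₅ b τ = zeta 24 ^ (-5 * b) * thetaTilde₅ 0 (τ + b) := by
  simp only [thetaTilde₅, mul_zero, zpow_zero, one_mul]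
  rw [theta_add_int ![2, 3, 3, 2] 0 1 (by decide +kernel) (by decide +kernel) b τ,
    theta_add_int ![1, 1, 1, 1] 1 0 (by decide +kernel) (by decide +kernel) b τ,
    theta_add_int ![3, 3, 2, 1] 1 1 (by decide +kernel) (by decide +kernel) b τ,
    theta_add_int ![4, 6, 4, 2] 1 3 (by decide +kernel) (by decide +kernel) b τ,
    theta_add_int ![1, 2, 2, 1] 2 0 (by decide +kernel) (by decide +kernel) b τ,
    theta_add_int ![4, 4, 4, 2] 2 2 (by decide +kernel) (by decide +kernel) b τ,
    theta_add_int ![2, 3, 4, 2] 2 1 (by decide +kernel) (by decide +kernel) b τ,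
    theta_add_int ![2, 4, 4, 2] 3 1 (by decide +kernel) (by decide +kernel) b τ,
    theta_add_int ![2, 2, 2, 1] 3 0 (by decide +kernel) (by decide +kernel) b τ,
    theta_add_int ![4, 6, 8, 4] 3 5 (by decide +kernel) (by decide +kernel) b τ,
    theta_add_int ![2, 2, 2, 2] 4 0 (by decide +kernel) (by decide +kernel) b τ,
    theta_add_int ![6, 6, 4, 2] 4 4 (by decide +kernel) (by decide +kernel) b τ,
    theta_add_int ![2, 3, 2, 1] 4 0 (by decide +kernel) (by decide +kernel) b τ]
  simp only [zero_mul, zpow_zero, one_mul]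
  ring

theorem etaQuotient_eq_thetaTilde₅ (b : ℤ) (τ : ℂ) (hτ : 0 < τ.im) :
    etaQuotient 1 b 5 τ = thetaTilde₅ b τ := by
  rw [etaQuotient_shift, thetaTilde₅_shift, etaQuotient_zero _ (by simpa using hτ)]

/-! ### The inversion `τ ↦ -1/τ` -/

theorem eq_of_exp_eq {a b : ℂ} (h : cexp a = cexp b) (h1 : -(2 * Real.pi) < a.im - b.im)
    (h2 : a.im - b.im < 2 * Real.pi) : a = b := by
  obtain ⟨n, hn⟩ := Complex.exp_eq_exp_iff_exists_int.mp h
  have hi : a.im - b.im = n * (2 * Real.pi) := by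
    rw [hn]; simp
  rw [hi] at h1 h2
  have hp := Real.two_pi_pos
  have l1 : (-1 : ℝ) < n := by nlinarith
  have l2 : (n : ℝ) < 1 := by nlinarith
  have : n = 0 := by
    have : (-1 : ℤ) < n := by exact_mod_cast l1
    have : n < (1 : ℤ) := by exact_mod_cast l2
    omega
  rw [hn, this]; simp

theorem ne_zero_of_im_pos {z : ℂ} (hz : 0 < z.im) : z ≠ 0 := by
  rintro rfl; simp at hz

theorem im_neg_one_div {z : ℂ} (hz : 0 < z.im) : 0 < (-1 / z).im := by
  rw [neg_div, one_div, neg_im, inv_im]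
  have := normSq_pos.mpr (ne_zero_of_im_pos hz)
  rw [neg_div, neg_neg]
  positivity

/-- The logarithm of `-i z` on the upper half-plane. -/
def logI (z : ℂ) : ℂ := Complex.log (-I * z)

theorem exp_logI {z : ℂ} (hz : 0 < z.im) : cexp (logI z) = -I * z :=
  Complex.exp_log (mul_ne_zero (neg_ne_zero.mpr I_ne_zero) (ne_zero_of_im_pos hz))

theorem abs_logI_im {z : ℂ} (hz : 0 < z.im) : |(logI z).im| < Real.pi / 2 := by
  rw [logI, Complex.log_im, Complex.abs_arg_lt_pi_div_two_iff]
  left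
  simpa using hz

theorem log_eq_logI {z : ℂ} (hz : 0 < z.im) : Complex.log z = logI z + Real.pi / 2 * I := by
  have hp := Real.pi_pos
  have h := abs_lt.mp (abs_logI_im hz)
  have a1 := Complex.neg_pi_lt_log_im z
  have a2 := Complex.log_im_le_pi z
  have e : (logI z + Real.pi / 2 * I).im = (logI z).im + Real.pi / 2 := by
    simp
  refine eq_of_exp_eq ?_ ?_ ?_
  · rw [Complex.exp_log (ne_zero_of_im_pos hz), Complex.exp_add, exp_logI hz,
      Complex.exp_pi_div_two_mul_I]
    linear_combination z * I_mul_I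
  · rw [e]; linarith
  · rw [e]; linarith

theorem eta_neg_one_div {z : ℂ} (hz : 0 < z.im) :
    ModularForm.eta (-1 / z) = cexp (logI z / 2) * ModularForm.eta z := by
  have h := ModularForm.eta_comp_eq_csqrt_I_inv (show z ∈ UpperHalfPlane.upperHalfPlaneSet from hz)
  simp only [Function.comp, Pi.smul_apply, Pi.mul_apply, smul_eq_mul] at h
  rw [h, ← mul_assoc, _root_.sqrt_eq_exp I_ne_zero, _root_.sqrt_eq_exp (ne_zero_of_im_pos hz),
    log_eq_logI hz, Complex.log_I, ← Complex.exp_neg, ← Complex.exp_add]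
  congr 2
  ring

theorem eta_pow_neg_one_div {z : ℂ} (hz : 0 < z.im) :
    ModularForm.eta (-1 / z) ^ 5 = (-I * z) ^ 2 * cexp (logI z / 2) * ModularForm.eta z ^ 5 := by
  have h : cexp (logI z / 2) ^ 2 = -I * z := by
    rw [← exp_logI hz, ← Complex.exp_nat_mul]; congr 1; push_cast; ring
  rw [eta_neg_one_div hz, ← h]
  ring

theorem etaQuotient_five_S {τ : ℂ} (hτ : 0 < τ.im) :
    etaQuotient 5 0 1 (-1 / τ) = (-I * τ) ^ 2 * (Real.sqrt 5 : ℂ) * etaQuotient 1 0 5 τ := by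
  have e : (((5 : ℤ) : ℂ) * (-1 / τ) + (0 : ℤ)) / (1 : ℤ) = -1 / (τ / 5) := by
    have := ne_zero_of_im_pos hτ
    push_cast
    field_simp
    ring
  have h5 := im_div_five hτ
  have hl : logI τ = Real.log 5 + logI (τ / 5) := by
    rw [logI, logI, ← Complex.log_ofReal_mul (by norm_num)
      (mul_ne_zero (neg_ne_zero.mpr I_ne_zero) (ne_zero_of_im_pos h5))]
    congr 1
    push_cast
    ring
  -- The factor `√5` is the ratio of the weight-1/2 multipliers of eta at `τ` and at `τ / 5`.
  have hs : cexp (logI τ / 2) = (Real.sqrt 5 : ℂ) * cexp (logI (τ / 5) / 2) := by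
    rw [hl, add_div, Complex.exp_add, Real.sqrt_eq_rpow, Real.rpow_def_of_pos (by norm_num)]
    push_cast
    congr 2
    ring
  have e' : (((1 : ℤ) : ℂ) * τ + (0 : ℤ)) / (5 : ℤ) = τ / 5 := by push_cast; ring
  rw [etaQuotient, etaQuotient, e, e', eta_pow_neg_one_div hτ, eta_neg_one_div h5, hs]
  have n1 := Complex.exp_ne_zero (logI (τ / 5) / 2)
  have n2 : ModularForm.eta (τ / 5) ≠ 0 := ModularForm.eta_ne_zero h5
  field_simp

theorem eta_sub_one (z : ℂ) : ModularForm.eta (z - 1) = (zeta 24)⁻¹ * ModularForm.eta z := by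
  have := eta_add_int z (-1)
  rwa [zpow_neg_one, Int.cast_neg, Int.cast_one, ← sub_eq_add_neg] at this

theorem etaQuotient_one_S {τ : ℂ} (hτ : 0 < τ.im) :
    etaQuotient 1 1 5 (-1 / τ) = (-I * τ) ^ 2 * zeta 8 * etaQuotient 1 4 5 τ := by
  have hp := Real.pi_pos
  obtain ⟨w, hw⟩ : ∃ w, w = (τ + 4) / 5 := ⟨_, rfl⟩
  have hτw : τ = 5 * w - 4 := by rw [hw]; ring
  have w1 : 0 < (w - 1).im := by
    have : (5 * (w - 1)).im = τ.im := by rw [hτw]; simp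
    simp only [mul_im] at this
    simp at this
    simp
    linarith
  have wn := ne_zero_of_im_pos w1
  have w0 : 0 < w.im := by simpa using w1
  -- The substitution is `S T⁻⁵ S T⁻¹` applied to `w`. The translations contribute `ζ₂₄⁻⁶` and the
  -- jump `πi/2` of logarithms contributes `ζ₈`, which leaves `ζ₈⁻¹` in `key`.
  obtain ⟨u, hu⟩ : ∃ u, u = -1 / (w - 1) + ((-5 : ℤ) : ℂ) := ⟨_, rfl⟩
  have u0 : 0 < u.im := by
    rw [hu]; simpa using im_neg_one_div w1
  have huw : u * (w - 1) = -τ := by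
    rw [hu, hτw]; field_simp; push_cast; ring
  have un := ne_zero_of_im_pos u0
  have τn := ne_zero_of_im_pos hτ
  have e1 : (((1 : ℤ) : ℂ) * (-1 / τ) + (1 : ℤ)) / (5 : ℤ) = -1 / u := by
    have e : (τ - 1) * u = -(5 * τ) := by
      rw [hτw] at huw ⊢; linear_combination 5 * huw
    push_cast
    field_simp
    linear_combination e
  have e2 : (((1 : ℤ) : ℂ) * τ + (4 : ℤ)) / (5 : ℤ) = w := by rw [hw]; push_cast; ring
  have hl : logI u + logI (w - 1) = logI τ + Real.pi / 2 * I := by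
    have a1 := abs_lt.mp (abs_logI_im u0)
    have a2 := abs_lt.mp (abs_logI_im w1)
    have a3 := abs_lt.mp (abs_logI_im hτ)
    have e : (logI τ + Real.pi / 2 * I).im = (logI τ).im + Real.pi / 2 := by simp
    refine eq_of_exp_eq ?_ ?_ ?_
    · rw [Complex.exp_add, Complex.exp_add, exp_logI u0, exp_logI w1, exp_logI hτ,
        Complex.exp_pi_div_two_mul_I]
      linear_combination I * I * huw
    · rw [e, add_im]; linarith
    · rw [e, add_im]; linarith
  have key : ModularForm.eta (-1 / u) =
      cexp (logI τ / 2) * (zeta 8)⁻¹ * ModularForm.eta w := by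
    have hz : cexp (logI u / 2) * zeta 24 ^ (-5 : ℤ) * cexp (logI (w - 1) / 2) * (zeta 24)⁻¹ =
        cexp (logI τ / 2) * (zeta 8)⁻¹ := by
      rw [zeta, zeta, ← Complex.exp_int_mul, ← Complex.exp_neg, ← Complex.exp_neg,
        ← Complex.exp_add, ← Complex.exp_add, ← Complex.exp_add, ← Complex.exp_add]
      congr 1
      push_cast
      linear_combination hl / 2
    rw [← hz, eta_neg_one_div u0, hu, eta_add_int, eta_neg_one_div w1, eta_sub_one, ← hu]
    ring
  have n1 := Complex.exp_ne_zero (logI τ / 2)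
  have n2 : ModularForm.eta w ≠ 0 := ModularForm.eta_ne_zero w0
  have n3 := zeta_ne_zero 8
  rw [etaQuotient, etaQuotient, e1, e2, key, eta_pow_neg_one_div hτ]
  field_simp

theorem etaQuotient_two_S {c : ℤ} (hc : c ^ 2 = 4) {τ : ℂ} (hτ : 0 < τ.im) :
    etaQuotient 1 c 5 (-1 / τ) = (-I * τ) ^ 2 * etaQuotient 1 c 5 τ := by
  have hp := Real.pi_pos
  have hcc : (c : ℂ) ^ 2 = 4 := by exact_mod_cast hc
  have hc0 : (c : ℝ) ≠ 0 := by
    intro h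
    have : c = 0 := by exact_mod_cast h
    rw [this] at hc; norm_num at hc
  obtain ⟨w, hw⟩ : ∃ w, w = (τ + c) / 5 := ⟨_, rfl⟩
  have hτw : τ = 5 * w - c := by rw [hw]; ring
  have w0 : 0 < w.im := by
    have : (5 * w).im = τ.im := by rw [hτw]; simp
    simp only [mul_im] at this
    simp at this
    linarith
  have wn := ne_zero_of_im_pos w0
  -- The substitution is `S T⁻ᶜ S Tᶜ S` applied to `w`, so the translation multipliers cancel; `c ^
  -- 2 = 4` makes the determinants match, as `c ^ 2 + 1 = 5`.
  obtain ⟨v, hv⟩ : ∃ v, v = -1 / w + (c : ℂ) := ⟨_, rfl⟩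
  have v0 : 0 < v.im := by rw [hv]; simpa using im_neg_one_div w0
  have vn := ne_zero_of_im_pos v0
  obtain ⟨u, hu⟩ : ∃ u, u = -1 / v + ((-c : ℤ) : ℂ) := ⟨_, rfl⟩
  have u0 : 0 < u.im := by rw [hu]; simpa using im_neg_one_div v0
  have un := ne_zero_of_im_pos u0
  have τn := ne_zero_of_im_pos hτ
  have hvw : v * w = c * w - 1 := by rw [hv]; field_simp; ring
  have huv : u * (v * w) = -τ := by
    have : u * v = -1 - c * v := by rw [hu]; push_cast; field_simp; ring
    rw [← mul_assoc, this, hτw]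
    linear_combination (-c : ℂ) * hvw - w * hcc
  have e1 : (((1 : ℤ) : ℂ) * (-1 / τ) + (c : ℤ)) / (5 : ℤ) = -1 / u := by
    have e : (c * τ - 1) * u = -(5 * τ) := by
      rw [hvw] at huv
      have : (c : ℂ) * τ - 1 = 5 * (c * w - 1) := by
        rw [hτw]; linear_combination (-1 : ℂ) * hcc
      rw [this]; linear_combination 5 * huv
    push_cast
    field_simp
    linear_combination e
  have e2 : (((1 : ℤ) : ℂ) * τ + (c : ℤ)) / (5 : ℤ) = w := by rw [hw]; push_cast; ring
  have hm : (-(v * w)).im ≠ 0 := by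
    rw [hvw]
    simp [hc0, w0.ne']
  have mn : -(v * w) ≠ 0 := neg_ne_zero.mpr (mul_ne_zero vn wn)
  have b1 := Complex.neg_pi_lt_log_im (-(v * w))
  have b2 : (Complex.log (-(v * w))).im < Real.pi := by
    rw [Complex.log_im, Complex.arg_lt_pi_iff]
    exact Or.inr hm
  have a1 := abs_lt.mp (abs_logI_im u0)
  have a2 := abs_lt.mp (abs_logI_im v0)
  have a3 := abs_lt.mp (abs_logI_im w0)
  have a4 := abs_lt.mp (abs_logI_im hτ)
  have l1 : logI v + logI w = Complex.log (-(v * w)) := by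
    refine eq_of_exp_eq ?_ ?_ ?_
    · rw [Complex.exp_add, exp_logI v0, exp_logI w0, Complex.exp_log mn]
      linear_combination v * w * I_mul_I
    · rw [add_im]; linarith
    · rw [add_im]; linarith
  have l2 : logI u + Complex.log (-(v * w)) = logI τ := by
    refine eq_of_exp_eq ?_ ?_ ?_
    · rw [Complex.exp_add, exp_logI u0, Complex.exp_log mn, exp_logI hτ]
      linear_combination I * huv
    · rw [add_im]; linarith
    · rw [add_im]; linarith
  have key : ModularForm.eta (-1 / u) = cexp (logI τ / 2) * ModularForm.eta w := by
    have hz : cexp (logI τ / 2) = cexp (logI u / 2) * cexp (logI v / 2) * cexp (logI w / 2) := by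
      rw [← Complex.exp_add, ← Complex.exp_add]
      congr 1
      linear_combination -(l1 + l2) / 2
    have hr : zeta 24 ^ (-c) * zeta 24 ^ c = 1 := by
      rw [← zpow_add₀ (zeta_ne_zero 24), neg_add_cancel, zpow_zero]
    rw [hz, eta_neg_one_div u0, hu, eta_add_int, eta_neg_one_div v0, hv, eta_add_int,
      eta_neg_one_div w0, ← hv, ← hu]
    linear_combination cexp (logI u / 2) * cexp (logI v / 2) * cexp (logI w / 2) *
      ModularForm.eta w * hr
  have n1 := Complex.exp_ne_zero (logI τ / 2)
  have n2 : ModularForm.eta w ≠ 0 := ModularForm.eta_ne_zero w0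
  rw [etaQuotient, etaQuotient, e1, e2, key, eta_pow_neg_one_div hτ]
  field_simp

theorem etaQuotient_add_five (b : ℤ) (τ : ℂ) :
    etaQuotient 1 (b + 5) 5 τ = (zeta 24)⁻¹ * etaQuotient 1 b 5 τ := by
  have e : (((1 : ℤ) : ℂ) * τ + (b + 5 : ℤ)) / (5 : ℤ) =
      (((1 : ℤ) : ℂ) * τ + (b : ℤ)) / (5 : ℤ) + 1 := by
    push_cast; ring
  rw [etaQuotient, etaQuotient, e, eta_add_one, ← div_div, div_right_comm, div_eq_inv_mul]

theorem sTransformationLaws_etaQuotient :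
    STransformationLaws (etaQuotient 5 0 1) (fun b => etaQuotient 1 b 5) := by
  intro τ hτ
  refine ⟨etaQuotient_five_S hτ, etaQuotient_one_S hτ, etaQuotient_two_S (by norm_num) hτ, ?_⟩
  -- The case `b = 3` is `c = -2` moved by 5, which multiplies both sides by the same constant.
  have h := etaQuotient_two_S (c := -2) (by norm_num) hτ
  have e := etaQuotient_add_five (-2)
  norm_num at e
  simp only [e, h]
  ring

theorem sTransformationLaws_thetaTilde : STransformationLaws thetaTilde₁ thetaTilde₅ := by
  intro τ hτ
  have h := sTransformationLaws_etaQuotient τ hτ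
  have hS := im_neg_one_div hτ
  simpa only [etaQuotient_five _ hS, etaQuotient_eq_thetaTilde₅ _ _ hS,
    etaQuotient_eq_thetaTilde₅ _ _ hτ] using h

end A4Theta

end

noncomputable section

namespace A4Theta

/-! ### Combinations over `M* / 5M` twisted by roots of unity -/

/-- `F` is a combination of theta functions of the kind in the last part of the theorem. -/
def IsTwistedCombination (F : ℂ → ℂ) : Prop :=
  ∃ (n : WeightClass →₀ ℤ) (k₁ k₂ : WeightClass → ℤ), ∀ τ : ℂ, 0 < τ.im →
    F τ = n.sum (fun c nc => (nc : ℂ) * zeta 24 ^ k₁ c * zeta 25 ^ k₂ c * thetaClass c τ)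

/-- Distinct invariants force distinct classes, so exponents indexed by the summands extend to
functions on `M* / 5M`, with default value 0 elsewhere. -/
theorem isTwistedCombination_of_sum {ι : Type*} [Fintype ι] {β : ι → Weight}
    (hβ : Function.Injective fun i => orbitInvariant (β i)) (n k₁ k₂ : ι → ℤ) {F : ℂ → ℂ}
    (hF : ∀ τ : ℂ, 0 < τ.im →
      F τ = ∑ i, (n i : ℂ) * zeta 24 ^ k₁ i * zeta 25 ^ k₂ i * theta (β i) τ) :
    IsTwistedCombination F := by
  have hinj : Function.Injective fun i => (Submodule.Quotient.mk (β i) : WeightClass) := by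
    intro i j h
    exact hβ (orbitInvariant_eq_of_sameOrbit
      (.of_sub_mem ((Submodule.Quotient.eq fiveM).mp h)))
  refine ⟨∑ i, Finsupp.single (Submodule.Quotient.mk (β i)) (n i),
    Function.extend (fun i => (Submodule.Quotient.mk (β i) : WeightClass)) k₁ 0,
    Function.extend (fun i => (Submodule.Quotient.mk (β i) : WeightClass)) k₂ 0,
    fun τ hτ => ?_⟩
  rw [hF τ hτ, ← Finsupp.sum_finsetSum_index (by simp) (by intros; push_cast; ring)]
  refine Finset.sum_congr rfl fun i _ => ?_
  rw [Finsupp.sum_single_index (by simp), hinj.extend_apply, hinj.extend_apply]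
  rfl

theorem zeta_five_eq : zeta 5 = zeta 25 ^ (5 : ℤ) := by
  rw [zeta, zeta, ← Complex.exp_int_mul]
  congr 1; push_cast; ring

theorem zeta_five_zpow (n : ℤ) : zeta 5 ^ n = zeta 25 ^ (5 * n) := by
  rw [zeta_five_eq, ← zpow_mul]

theorem isTwistedCombination_thetaTilde₁ : IsTwistedCombination thetaTilde₁ := by
  refine isTwistedCombination_of_sum
    (β := ![![0, 0, 0, 0], ![5, 0, 0, 0], ![10, 0, 0, 0], ![1, 1, 1, 1]])
    (by decide +kernel) ![1, 2, 2, -5] 0 0 fun τ _ => ?_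
  simp [Fin.sum_univ_four, thetaTilde₁]
  ring

theorem isTwistedCombination_thetaTilde₅ (b : ℤ) : IsTwistedCombination (thetaTilde₅ b) := by
  refine isTwistedCombination_of_sum
    (β := ![![1, 1, 1, 1], ![1, 0, 0, 1], ![3, 1, 0, 0], ![2, 4, 0, 0], ![0, 1, 1, 0],
      ![4, 0, 2, 0], ![1, 0, 3, 0], ![0, 2, 2, 0], ![2, 0, 1, 0], ![2, 0, 6, 0], ![2, 0, 0, 2],
      ![6, 2, 0, 0], ![1, 2, 0, 0]])
    (by decide +kernel) ![5, 1, 2, 2, 1, 2, 2, 1, 2, 2, 1, 2, 2] (fun _ => -5 * b)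
    ![0, 5 * b, 5 * b, 5 * b, 5 * (2 * b), 5 * (2 * b), 5 * (2 * b), 5 * (3 * b), 5 * (3 * b),
      5 * (3 * b), 5 * (4 * b), 5 * (4 * b), 5 * (4 * b)] fun τ _ => ?_
  rw [thetaTilde₅]
  simp only [zeta_five_zpow, Fin.sum_univ_succ, Fin.sum_univ_zero]
  simp
  ring

theorem isTwistedCombination_etaQuotient {a b d : ℤ} (had : a * d = 5) (hb : 0 ≤ b)
    (hbd : b < d) : IsTwistedCombination (etaQuotient a b d) := by
  have hd : d ∣ 5 := Dvd.intro_left a had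
  have hd5 : d ≤ 5 := Int.le_of_dvd (by norm_num) hd
  have hd0 : 0 < d := by omega
  have hcases : d = 1 ∨ d = 5 := by
    interval_cases d <;> omega
  rcases hcases with rfl | rfl
  · obtain rfl : a = 5 := by omega
    obtain rfl : b = 0 := by omega
    obtain ⟨n, k₁, k₂, h⟩ := isTwistedCombination_thetaTilde₁
    exact ⟨n, k₁, k₂, fun τ hτ => (etaQuotient_five τ hτ).trans (h τ hτ)⟩
  · obtain rfl : a = 1 := by omega
    obtain ⟨n, k₁, k₂, h⟩ := isTwistedCombination_thetaTilde₅ b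
    exact ⟨n, k₁, k₂, fun τ hτ => (etaQuotient_eq_thetaTilde₅ b τ hτ).trans (h τ hτ)⟩

end A4Theta

end

theorem mainTheorem2 :
    -- the theta series converge absolutely
    (∀ (β : A4Theta.Weight) (τ : ℂ), 0 < τ.im → Summable (A4Theta.thetaTerm β τ)) ∧
    -- the 66 orbits and their representatives
    A4Theta.orbitReps.card = 66 ∧
    (∀ β : A4Theta.Weight, ∃! μ : A4Theta.Weight,
      μ ∈ A4Theta.orbitReps ∧ A4Theta.SameOrbit β μ) ∧
    (∀ β γ : A4Theta.Weight, A4Theta.SameOrbit β γ →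
      ∀ τ : ℂ, 0 < τ.im → A4Theta.theta β τ = A4Theta.theta γ τ) ∧
    -- the explicit theta identities
    (∀ τ : ℂ, 0 < τ.im → A4Theta.etaQuotient 5 0 1 τ = A4Theta.thetaTilde₁ τ) ∧
    (∀ b : ℤ, 0 ≤ b → b < 5 → ∀ τ : ℂ, 0 < τ.im →
      A4Theta.etaQuotient 1 b 5 τ = A4Theta.thetaTilde₅ b τ) ∧
    -- the transformation laws, for both families
    A4Theta.STransformationLaws A4Theta.thetaTilde₁ A4Theta.thetaTilde₅ ∧
    A4Theta.STransformationLaws (A4Theta.etaQuotient 5 0 1)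
      (fun b => A4Theta.etaQuotient 1 b 5) ∧
    -- integer combinations twisted by roots of unity, over `M* / 5M`
    (∀ a b d : ℤ, a * d = 5 → 0 ≤ b → b < d →
      ∃ (n : A4Theta.WeightClass →₀ ℤ) (k₁ k₂ : A4Theta.WeightClass → ℤ),
        ∀ τ : ℂ, 0 < τ.im →
          A4Theta.etaQuotient a b d τ =
            n.sum (fun c nc => (nc : ℂ) * A4Theta.zeta 24 ^ k₁ c * A4Theta.zeta 25 ^ k₂ c *
              A4Theta.thetaClass c τ)) := ⟨fun β _ hτ => A4Theta.summable_thetaTerm β hτ, A4Theta.card_orbitReps,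
    A4Theta.existsUnique_orbitReps, fun _ _ h τ _ => A4Theta.theta_eq_of_sameOrbit h τ,
    A4Theta.etaQuotient_five, fun b _ _ τ hτ => A4Theta.etaQuotient_eq_thetaTilde₅ b τ hτ,
    A4Theta.sTransformationLaws_thetaTilde, A4Theta.sTransformationLaws_etaQuotient,
    fun _ _ _ had hb hbd => A4Theta.isTwistedCombination_etaQuotient had hb hbd⟩
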